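/- **Notation.** For a finite set $X$ let $M_X$ be the algebra of complex $|X|\times|X|$ matrices, with matrix units $e_xe_{x'}^*$, and $M_{XY}=M_X\otimes M_Y$. A *quantum channel* is a completely positive trace preserving map $M_X\to M_A$. A *QNS correlation* is a quantum channel $\Gamma:M_{XY}\to M_{AB}$ with $\mathrm{Tr}_A\Gamma(\rho_X\otimes\rho_Y)=0$ whenever $\mathrm{Tr}\,\rho_X=0$, and $\mathrm{Tr}_B\Gamma(\rho_X\otimes\rho_Y)=0$ whenever $\mathrm{Tr}\,\rho_Y=0$; the set of these is $\mathcal Q_{\rm ns}$. A *stochastic operator matrix* over $(X,A)$ on a Hilbert space $H$ is a positive $E=(E_{x,x',a,a'})\in M_X\otimes M_A\otimes\mathcal B(H)$ with $\mathrm{Tr}_A E=I_X\otimes I_H$. - $\mathcal Q_{\rm qc}$ is the set of QNS correlations of the form $\Gamma(e_xe_{x'}^*\otimes e_ye_{y'}^*)=\sum_{a,a',b,b'}\langle E_{x,x',a,a'}F_{y,y',b,b'}\xi,\xi\rangle\, e_ae_{a'}^*\otimes e_be_{b'}^*$, where $E$ and $F$ are stochastic operator matrices over $(X,A)$ and $(Y,B)$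 on the same Hilbert space with commuting entries, and $\xi$ is a unit vector. - $\mathcal Q_{\rm q}$ is the set of QNS correlations given by the same formula with $E_{x,x',a,a'}\otimes F_{y,y',b,b'}$ in place of the product, where $E$, $F$ act on finite dimensional spaces $H_A$, $H_B$ and $\xi\in H_A\otimes H_B$ is a unit vector. - $\mathcal Q_{\rm qa}$ is the set of QNS correlations that are limits of sequences in $\mathcal Q_{\rm q}$. - $\mathcal Q_{\rm loc}$ is the set of QNS correlations that are convex combinations of maps $\Phi\otimes\Psi$ with $\Phi:M_X\to M_A$ and $\Psi:M_Y\to M_B$ quantum channels. Let $\mathcal C_{X,A}$ be the C*-algebra generated by the elements $e_{x,x',a,a'}=v_{a,x}^*v_{a',x'}$, where $(v_{a,x})_{a\in A,x\in X}$ is the universal family of operators $H\to K$ between Hilbert spaces with $\sum_{a}v_{a,x}^*v_{a,x'}=\delta_{x,x'}1$. For a functional $\tau$ on $\mathcal C_{X,A}$ set $\Gamma_\tau(e_xe_{x'}^*\otimes e_ye_{y'}^*)=\sum_{a,a',b,b'\in A}\tau(e_{x,x',a,a'}e_{y',y,b',b})\,e_ae_{a'}^*\otimes e_be_{b'}^*$.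 Traces are normalised (tracial states). A QNS correlation $\Gamma:M_{XX}\to M_{AA}$ is *tracial* if $\Gamma=\Gamma_\tau$ for a trace $\tau$ on $\mathcal C_{X,A}$; it is *quantum tracial* (resp. *locally tracial*) if $\Gamma=\Gamma_{\tau\circ\pi}$ for a unital *-homomorphism $\pi$ from $\mathcal C_{X,A}$ into a unital C*-algebra $\mathcal A$ that is finite dimensional (resp. abelian) and a trace (resp. state) $\tau$ on $\mathcal A$. A *quantum non-local game* from $XY$ to $AB$ is a map $\varphi$ from the projections in $M_{XY}$ to the projections in $M_{AB}$ which preserves arbitrary joins and satisfies $\varphi(0)=0$. A QNS correlation $\Gamma:M_{XY}\to M_{AB}$ is a *perfect strategy* for $\varphi$ if $\langle\Gamma(P),\varphi(P)_\perp\rangle=0$ for every projection $P\in M_{XY}$; here $\langle\rho,\omega\rangle=\mathrm{Tr}(\rho\,\omega^{\rm t})$ and $Q_\perp=(I-Q)^{\rm t}$, so that the condition reads $\mathrm{Tr}\big(\Gamma(P)(I-\varphi(P))\big)=0$. **Theorem.** Let $X,Y,A,B,Z,W$ be finite sets, and let $\varphi_1$ and $\varphi_2$ be quantum non-local games from $XY$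 to $AB$ and from $AB$ to $ZW$, respectively. (i) Let $\mathrm x\in\{\mathrm{loc},\mathrm q,\mathrm{qa},\mathrm{qc},\mathrm{ns}\}$. If $\Gamma_i$ is a perfect strategy for $\varphi_i$ from the class $\mathcal Q_{\rm x}$, $i=1,2$, then $\Gamma_2\circ\Gamma_1$ is a perfect strategy for the game $\varphi_2\circ\varphi_1$ from the class $\mathcal Q_{\rm x}$. (ii) Assume that $X=Y$, $A=B$ and $Z=W$. If $\Gamma_i$ is a perfect strategy for $\varphi_i$ that is tracial (resp. quantum tracial, locally tracial), $i=1,2$, then $\Gamma_2\circ\Gamma_1$ is a perfect strategy for $\varphi_2\circ\varphi_1$ that is tracial (resp. quantum tracial, locally tracial). -/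

import Mathlib

open scoped ComplexOrder Matrix Kronecker TensorProduct ENNReal InnerProductSpace

noncomputable section

namespace QNG

/-! ### Quantum channels and no-signalling correlations

For a finite set `X`, the algebra `M_X` is `Matrix X X ℂ`, and `M_{XY} = M_X ⊗ M_Y` is
`Matrix (X × Y) (X × Y) ℂ`, elementary tensors being Kronecker products. -/

/-- The partial trace over the first tensor factor, `M_{AB} → M_B`. -/
def trLeft {A B : Type} [Fintype A] (M : Matrix (A × B) (A × B) ℂ) : Matrix B B ℂ :=
  Matrix.of fun b b' => ∑ a, M (a, b) (a, b')

/-- The partial trace over the second tensor factor, `M_{AB} → M_A`. -/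
def trRight {A B : Type} [Fintype B] (M : Matrix (A × B) (A × B) ℂ) : Matrix A A ℂ :=
  Matrix.of fun a a' => ∑ b, M (a, b) (a', b)

/-- Complete positivity: for every `n`, applying `Φ` to the entries of an `n × n` matrix over `M_X`
maps positive elements of `M_n(M_X)` to positive elements of `M_n(M_A)`. -/
def IsCP {X A : Type} (Φ : Matrix X X ℂ →ₗ[ℂ] Matrix A A ℂ) : Prop :=
  ∀ (n : ℕ) (M : Matrix (Fin n) (Fin n) (Matrix X X ℂ)),
    (Matrix.comp _ _ _ _ _ M).PosSemidef → (Matrix.comp _ _ _ _ _ (M.map Φ)).PosSemidef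

/-- Quantum channels: completely positive trace preserving maps. -/
def IsChannel {X A : Type} [Fintype X] [Fintype A]
    (Φ : Matrix X X ℂ →ₗ[ℂ] Matrix A A ℂ) : Prop :=
  IsCP Φ ∧ ∀ ρ, (Φ ρ).trace = ρ.trace

/-- Linear maps `M_{XY} → M_{AB}`. -/
abbrev CorrMap (X Y A B : Type) : Type :=
  Matrix (X × Y) (X × Y) ℂ →ₗ[ℂ] Matrix (A × B) (A × B) ℂ

/-- Quantum no-signalling (QNS) correlations. -/
structure IsQNS {X Y A B : Type} [Fintype X] [Fintype Y] [Fintype A] [Fintype B]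
    (Γ : CorrMap X Y A B) : Prop where
  channel : IsChannel Γ
  left : ∀ (ρ : Matrix X X ℂ) (σ : Matrix Y Y ℂ), ρ.trace = 0 → trLeft (Γ (ρ ⊗ₖ σ)) = 0
  right : ∀ (ρ : Matrix X X ℂ) (σ : Matrix Y Y ℂ), σ.trace = 0 → trRight (Γ (ρ ⊗ₖ σ)) = 0

/-- The linear map `M_X → M_A` sending the matrix unit `e_x e_{x'}^*` to
`∑_{a,a'} c_{(x,a),(x',a')} e_a e_{a'}^*`, that is, the map with Choi matrix `c`. -/
def ofChoi {X A : Type} [Fintype X] (c : Matrix (X × A) (X × A) ℂ) :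
    Matrix X X ℂ →ₗ[ℂ] Matrix A A ℂ where
  toFun ρ := Matrix.of fun a a' => ∑ x, ∑ x', ρ x x' * c (x, a) (x', a')
  map_add' ρ σ := by
    ext a a'
    simp [add_mul, Finset.sum_add_distrib]
  map_smul' r ρ := by
    ext a a'
    simp [mul_assoc, Finset.mul_sum]

/-- The tensor product `Φ ⊗ Ψ : M_{XY} → M_{AB}` of linear maps, determined by its values
`Φ(e_x e_{x'}^*) ⊗ Ψ(e_y e_{y'}^*)` on matrix units. -/
def tensorMap {X Y A B : Type} [Fintype X] [Fintype Y] [DecidableEq X] [DecidableEq Y]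
    (Φ : Matrix X X ℂ →ₗ[ℂ] Matrix A A ℂ) (Ψ : Matrix Y Y ℂ →ₗ[ℂ] Matrix B B ℂ) :
    CorrMap X Y A B :=
  ofChoi fun i j =>
    Φ (Matrix.single i.1.1 j.1.1 1) i.2.1 j.2.1 * Ψ (Matrix.single i.1.2 j.1.2 1) i.2.2 j.2.2

/-- `Φ ⊗ Ψ` acts on elementary tensors as expected. -/
theorem tensorMap_kronecker {X Y A B : Type} [Fintype X] [Fintype Y] [DecidableEq X]
    [DecidableEq Y] (Φ : Matrix X X ℂ →ₗ[ℂ] Matrix A A ℂ) (Ψ : Matrix Y Y ℂ →ₗ[ℂ] Matrix B B ℂ)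
    (ρ : Matrix X X ℂ) (σ : Matrix Y Y ℂ) :
    tensorMap Φ Ψ (ρ ⊗ₖ σ) = Φ ρ ⊗ₖ Ψ σ := by
  have key : ∀ {X A : Type} [Fintype X] [DecidableEq X] (Φ : Matrix X X ℂ →ₗ[ℂ] Matrix A A ℂ)
      (ρ : Matrix X X ℂ) (a a' : A),
      Φ ρ a a' = ∑ x, ∑ x', ρ x x' * Φ (Matrix.single x x' 1) a a' := by
    intro X A _ _ Φ ρ a a'
    conv_lhs => rw [Matrix.matrix_eq_sum_single ρ]
    simp only [map_sum, Matrix.sum_apply]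
    refine Finset.sum_congr rfl fun x _ => Finset.sum_congr rfl fun x' _ => ?_
    have h : Matrix.single x x' (ρ x x') = ρ x x' • Matrix.single x x' (1 : ℂ) := by simp
    rw [h, map_smul]
    simp
  ext ⟨a, b⟩ ⟨a', b'⟩
  rw [Matrix.kroneckerMap_apply, key Φ ρ, key Ψ σ]
  simp only [tensorMap, ofChoi, LinearMap.coe_mk, AddHom.coe_mk, Matrix.of_apply,
    Matrix.kroneckerMap_apply, Fintype.sum_prod_type, Finset.sum_mul_sum]
  refine Finset.sum_congr rfl fun x _ => Finset.sum_congr rfl fun y _ => ?_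
  refine Finset.sum_congr rfl fun x' _ => Finset.sum_congr rfl fun y' _ => ?_
  ring

/-! ### Stochastic operator matrices and the classes of QNS correlations -/

/-- A stochastic operator matrix over `(X, A)` acting on the Hilbert space `H`: a matrix
`E = (E_{x,x',a,a'})` of bounded operators, stored as `E (x, a) (x', a') = E_{x,x',a,a'}`, which is
positive as an operator on the direct sum of `|X × A|` copies of `H` and satisfies
`Tr_A E = I_X ⊗ I_H`. -/
structure IsStochOp {X A H : Type} [Fintype X] [Fintype A] [DecidableEq X]
    [NormedAddCommGroup H] [InnerProductSpace ℂ H]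
    (E : Matrix (X × A) (X × A) (H →L[ℂ] H)) : Prop where
  pos : ∀ ξ : X × A → H, 0 ≤ ∑ i, ∑ j, ⟪ξ i, E i j (ξ j)⟫_ℂ
  trace : ∀ x x', ∑ a, E (x, a) (x', a) = if x = x' then 1 else 0

/-- `Γ_{G, ξξ^*} : M_X → M_A`, which sends `e_x e_{x'}^*` to
`∑_{a,a'} ⟨G_{x,x',a,a'} ξ, ξ⟩ e_a e_{a'}^*` (inner product linear in the first variable). -/
def stateMap {X A H : Type} [Fintype X] [NormedAddCommGroup H] [InnerProductSpace ℂ H]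
    (G : Matrix (X × A) (X × A) (H →L[ℂ] H)) (ξ : H) : Matrix X X ℂ →ₗ[ℂ] Matrix A A ℂ :=
  ofChoi fun i j => ⟪ξ, G i j ξ⟫_ℂ

/-- The product `E · F = (E_{x,x',a,a'} F_{y,y',b,b'})` of operator matrices on the same space. -/
def dotOp {X Y A B H : Type} [NormedAddCommGroup H] [InnerProductSpace ℂ H]
    (E : Matrix (X × A) (X × A) (H →L[ℂ] H)) (F : Matrix (Y × B) (Y × B) (H →L[ℂ] H)) :
    Matrix ((X × Y) × (A × B)) ((X × Y) × (A × B)) (H →L[ℂ] H) :=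
  fun i j => E (i.1.1, i.2.1) (j.1.1, j.2.1) * F (i.1.2, i.2.2) (j.1.2, j.2.2)

/-- The tensor product `E ⊙ F = (E_{x,x',a,a'} ⊗ F_{y,y',b,b'})` of operator matrices acting on
finite dimensional spaces `H` and `K`, acting on `H ⊗ K`. -/
def odotOp {X Y A B H K : Type} [NormedAddCommGroup H] [InnerProductSpace ℂ H]
    [FiniteDimensional ℂ H] [NormedAddCommGroup K] [InnerProductSpace ℂ K] [FiniteDimensional ℂ K]
    (E : Matrix (X × A) (X × A) (H →L[ℂ] H)) (F : Matrix (Y × B) (Y × B) (K →L[ℂ] K)) :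
    Matrix ((X × Y) × (A × B)) ((X × Y) × (A × B)) (H ⊗[ℂ] K →L[ℂ] H ⊗[ℂ] K) :=
  fun i j => LinearMap.toContinuousLinearMap
    (TensorProduct.map (E (i.1.1, i.2.1) (j.1.1, j.2.1) : H →ₗ[ℂ] H)
      (F (i.1.2, i.2.2) (j.1.2, j.2.2) : K →ₗ[ℂ] K))

section classes

variable {X Y A B : Type} [Fintype X] [Fintype Y] [Fintype A] [Fintype B]
  [DecidableEq X] [DecidableEq Y]

/-- Local QNS correlations. -/
def IsLoc (Γ : CorrMap X Y A B) : Prop :=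
  IsQNS Γ ∧ Γ ∈ convexHull ℝ
    {Θ : CorrMap X Y A B | ∃ (Φ : Matrix X X ℂ →ₗ[ℂ] Matrix A A ℂ)
      (Ψ : Matrix Y Y ℂ →ₗ[ℂ] Matrix B B ℂ), IsChannel Φ ∧ IsChannel Ψ ∧ Θ = tensorMap Φ Ψ}

/-- Quantum QNS correlations. -/
def IsQ (Γ : CorrMap X Y A B) : Prop :=
  IsQNS Γ ∧ ∃ (H : Type) (_ : NormedAddCommGroup H) (_ : InnerProductSpace ℂ H)
    (_ : FiniteDimensional ℂ H) (K : Type) (_ : NormedAddCommGroup K)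
    (_ : InnerProductSpace ℂ K) (_ : FiniteDimensional ℂ K)
    (E : Matrix (X × A) (X × A) (H →L[ℂ] H)) (F : Matrix (Y × B) (Y × B) (K →L[ℂ] K))
    (ξ : H ⊗[ℂ] K), IsStochOp E ∧ IsStochOp F ∧ ‖ξ‖ = 1 ∧ Γ = stateMap (odotOp E F) ξ

/-- Approximately quantum QNS correlations: limits of sequences of quantum ones. -/
def IsQA (Γ : CorrMap X Y A B) : Prop :=
  IsQNS Γ ∧ ∃ Γs : ℕ → CorrMap X Y A B, (∀ n, IsQ (Γs n)) ∧
    ∀ ρ, Filter.Tendsto (fun n => Γs n ρ) Filter.atTop (nhds (Γ ρ))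

/-- Quantum commuting QNS correlations. -/
def IsQC (Γ : CorrMap X Y A B) : Prop :=
  IsQNS Γ ∧ ∃ (H : Type) (_ : NormedAddCommGroup H) (_ : InnerProductSpace ℂ H)
    (_ : CompleteSpace H)
    (E : Matrix (X × A) (X × A) (H →L[ℂ] H)) (F : Matrix (Y × B) (Y × B) (H →L[ℂ] H)) (ξ : H),
    IsStochOp E ∧ IsStochOp F ∧ (∀ i j k l, Commute (E i j) (F k l)) ∧ ‖ξ‖ = 1 ∧
      Γ = stateMap (dotOp E F) ξ

end classes

/-- The five types of correlations. -/
inductive CorrType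
  | loc
  | q
  | qa
  | qc
  | ns

/-- Membership in the class `𝒬_x`, for `x ∈ {loc, q, qa, qc, ns}`. -/
def InClass {X Y A B : Type} [Fintype X] [Fintype Y] [Fintype A] [Fintype B]
    [DecidableEq X] [DecidableEq Y] : CorrType → CorrMap X Y A B → Prop
  | .loc, Γ => IsLoc Γ
  | .q, Γ => IsQ Γ
  | .qa, Γ => IsQA Γ
  | .qc, Γ => IsQC Γ
  | .ns, Γ => IsQNS Γ

/-! ### The universal C*-algebra `𝒞_{X,A}`

`𝒞_{X,A}` is generated by the elements `e_{x,x',a,a'} = v_{a,x}^* v_{a',x'}`, where `(v_{a,x})` is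
the universal family with `∑_a v_{a,x}^* v_{a,x'} = δ_{x,x'}`. It is constructed as the norm closed
*-algebra generated by the corresponding operators in the direct sum of representations of these
relations. -/

/-- A representation of the relations `∑_a v_{a,x}^* v_{a,x'} = δ_{x,x'}` by bounded operators
`V_{a,x} : H → K` between Hilbert spaces, with `H ≠ 0`. -/
structure Rep (X A : Type) [Fintype A] [DecidableEq X] : Type 1 where
  H : Type
  K : Type
  [nH : NormedAddCommGroup H]
  [iH : InnerProductSpace ℂ H]
  [cH : CompleteSpace H]
  [tH : Nontrivial H]
  [nK : NormedAddCommGroup K]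
  [iK : InnerProductSpace ℂ K]
  [cK : CompleteSpace K]
  V : A → X → H →L[ℂ] K
  rel : ∀ x x', ∑ a, (V a x).adjoint ∘L V a x' =
    if x = x' then ContinuousLinearMap.id ℂ H else 0

attribute [instance] Rep.nH Rep.iH Rep.cH Rep.tH Rep.nK Rep.iK Rep.cK

section universal

variable {X A : Type} [Fintype A] [DecidableEq X]

/-- The operator `V_{a,x}^* V_{a',x'}`, for `g = (x, x', a, a')`. -/
def Rep.entry (R : Rep X A) (g : X × X × A × A) : R.H →L[ℂ] R.H :=
  (R.V g.2.2.1 g.1).adjoint ∘L R.V g.2.2.2 g.2.1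

theorem Rep.norm_V_le (R : Rep X A) (a : A) (x : X) : ‖R.V a x‖ ≤ 1 := by
  refine ContinuousLinearMap.opNorm_le_bound _ zero_le_one fun ξ => ?_
  have h := congrArg (fun T : R.H →L[ℂ] R.H => (⟪T ξ, ξ⟫_ℂ).re) (R.rel x x)
  simp only [if_true, _root_.sum_apply, ContinuousLinearMap.comp_apply, sum_inner,
    ContinuousLinearMap.adjoint_inner_left, ContinuousLinearMap.id_apply,
    inner_self_eq_norm_sq_to_K, Complex.re_sum] at h
  have h' : ∑ c, ‖R.V c x ξ‖ ^ 2 = ‖ξ‖ ^ 2 := by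
    have e : ∀ r : ℝ, (((r : ℂ)) ^ 2).re = r ^ 2 := fun r => by
      rw [← Complex.ofReal_pow, Complex.ofReal_re]
    simpa [e] using h
  have h1 : ‖R.V a x ξ‖ ^ 2 ≤ ‖ξ‖ ^ 2 := by
    rw [← h']
    exact Finset.single_le_sum (f := fun c => ‖R.V c x ξ‖ ^ 2) (fun c _ => sq_nonneg _)
      (Finset.mem_univ a)
  rw [one_mul]
  exact le_of_sq_le_sq h1 (norm_nonneg _)

theorem Rep.norm_entry_le (R : Rep X A) (g : X × X × A × A) : ‖R.entry g‖ ≤ 1 := by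
  refine (ContinuousLinearMap.opNorm_comp_le _ _).trans ?_
  rw [LinearIsometryEquiv.norm_map]
  exact mul_le_one₀ (R.norm_V_le _ _) (norm_nonneg _) (R.norm_V_le _ _)

/-- The seminorm `p ↦ ‖p(V_{a,x}^* V_{a',x'})‖` on noncommutative polynomials in the symbols
`e_{x,x',a,a'}` (which, as `e_{x,x',a,a'}^* = e_{x',x,a',a}`, include the *-polynomials). -/
def Rep.seminorm (R : Rep X A) (p : FreeAlgebra ℂ (X × X × A × A)) : ℝ :=
  ‖FreeAlgebra.lift ℂ R.entry p‖

variable (X A) in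
/-- The classes of representations, two of them being identified when they induce the same
seminorm. In contrast to all the representations, these form a set. -/
abbrev RepClass : Type := Set.range (Rep.seminorm : Rep X A → FreeAlgebra ℂ (X × X × A × A) → ℝ)

/-- A representation from the given class. -/
def RepClass.rep (i : RepClass X A) : Rep X A := i.2.choose

variable (X A) in
/-- The bounded families of operators on the spaces of the chosen representations, with the
pointwise operations and the supremum norm (the block diagonal operators on the direct sum of
the Hilbert spaces). -/
abbrev BlockAlg : Type := lp (fun i : RepClass X A => i.rep.H →L[ℂ] i.rep.H) ∞

instance : CStarAlgebra (BlockAlg X A) where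

/-- The element `(V_{a,x}^* V_{a',x'})_V` of the direct sum, for `g = (x, x', a, a')`. -/
def blockGen (g : X × X × A × A) : BlockAlg X A :=
  ⟨fun i => i.rep.entry g,
    memℓp_infty ⟨1, by rintro _ ⟨i, rfl⟩; exact i.rep.norm_entry_le g⟩⟩

variable (X A) in
/-- `𝒞_{X,A}`, as a C*-subalgebra of the direct sum. -/
def brownCuntz : StarSubalgebra ℂ (BlockAlg X A) :=
  (StarAlgebra.adjoin ℂ (Set.range (blockGen (X := X) (A := A)))).topologicalClosure

variable (X A) in
/-- The C*-algebra `𝒞_{X,A}`. -/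
abbrev BrownCuntz : Type := brownCuntz X A

instance : CStarAlgebra (BrownCuntz X A) :=
  StarSubalgebra.cstarAlgebra (brownCuntz X A)
    (h_closed := StarSubalgebra.isClosed_topologicalClosure _)

/-- The canonical generators `e_{x,x',a,a'}` of `𝒞_{X,A}`. -/
def gen (x x' : X) (a a' : A) : BrownCuntz X A :=
  ⟨blockGen (x, x', a, a'), StarSubalgebra.le_topologicalClosure _
    (StarAlgebra.subset_adjoin ℂ _ ⟨_, rfl⟩)⟩

end universal

/-! ### Tracial QNS correlations -/

/-- States of a unital C*-algebra. -/
def IsState {𝒜 : Type} [CStarAlgebra 𝒜] (τ : 𝒜 →ₗ[ℂ] ℂ) : Prop :=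
  τ 1 = 1 ∧ ∀ u, 0 ≤ τ (star u * u)

/-- (Normalised) traces on a unital C*-algebra. -/
def IsTrace {𝒜 : Type} [CStarAlgebra 𝒜] (τ : 𝒜 →ₗ[ℂ] ℂ) : Prop :=
  IsState τ ∧ ∀ u v, τ (u * v) = τ (v * u)

section tracial

variable {X A : Type} [Fintype X] [Fintype A] [DecidableEq X]

/-- The map `Γ_τ : M_{XX} → M_{AA}` which sends `e_x e_{x'}^* ⊗ e_y e_{y'}^*` to
`∑_{a,a',b,b'} τ(e_{x,x',a,a'} e_{y',y,b',b}) e_a e_{a'}^* ⊗ e_b e_{b'}^*`. -/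
def traceMap (τ : BrownCuntz X A →ₗ[ℂ] ℂ) : CorrMap X X A A :=
  ofChoi fun i j =>
    τ (gen i.1.1 j.1.1 i.2.1 j.2.1 * gen j.1.2 i.1.2 j.2.2 i.2.2)

/-- Tracial QNS correlations. -/
def IsTracial (Γ : CorrMap X X A A) : Prop :=
  IsQNS Γ ∧ ∃ τ : BrownCuntz X A →ₗ[ℂ] ℂ, IsTrace τ ∧ Γ = traceMap τ

/-- Quantum tracial QNS correlations. -/
def IsQTracial (Γ : CorrMap X X A A) : Prop :=
  IsQNS Γ ∧ ∃ (𝒜 : Type) (_ : CStarAlgebra 𝒜) (_ : FiniteDimensional ℂ 𝒜)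
    (τ : 𝒜 →ₗ[ℂ] ℂ) (π : BrownCuntz X A →⋆ₐ[ℂ] 𝒜),
    IsTrace τ ∧ Γ = traceMap (τ ∘ₗ π.toAlgHom.toLinearMap)

/-- Locally tracial QNS correlations. -/
def IsLocTracial (Γ : CorrMap X X A A) : Prop :=
  IsQNS Γ ∧ ∃ (𝒜 : Type) (_ : CStarAlgebra 𝒜) (_ : ∀ u v : 𝒜, u * v = v * u)
    (τ : 𝒜 →ₗ[ℂ] ℂ) (π : BrownCuntz X A →⋆ₐ[ℂ] 𝒜),
    IsState τ ∧ Γ = traceMap (τ ∘ₗ π.toAlgHom.toLinearMap)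

end tracial

/-! ### Quantum non-local games -/

/-- The orthogonal projections in `M_X`. -/
abbrev Proj (X : Type) [Fintype X] : Type := {P : Matrix X X ℂ // IsStarProjection P}

/-- The range of a projection. -/
def Proj.rng {X : Type} [Fintype X] (P : Proj X) : Submodule ℂ (X → ℂ) :=
  LinearMap.range P.1.mulVecLin

/-- `P` is the join of the set `S` of projections: its range is the span of their ranges. -/
def IsJoin {X : Type} [Fintype X] (S : Set (Proj X)) (P : Proj X) : Prop :=
  P.rng = ⨆ Q ∈ S, Q.rng

/-- The zero projection. -/
def Proj.zero (X : Type) [Fintype X] : Proj X := ⟨0, .zero _⟩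

/-- A quantum non-local game from `XY` to `AB`: a join continuous zero preserving map from the
projections in `M_{XY}` to the projections in `M_{AB}`. -/
structure Game (X Y A B : Type) [Fintype X] [Fintype Y] [Fintype A] [Fintype B] where
  toFun : Proj (X × Y) → Proj (A × B)
  map_join : ∀ S P, IsJoin S P → IsJoin (toFun '' S) (toFun P)
  map_zero : toFun (Proj.zero _) = Proj.zero _

/-- The composition `φ₂ ∘ φ₁` of games. -/
def Game.comp {X Y A B Z W : Type} [Fintype X] [Fintype Y] [Fintype A] [Fintype B]
    [Fintype Z] [Fintype W] (φ₂ : Game A B Z W) (φ₁ : Game X Y A B) : Game X Y Z W where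
  toFun P := φ₂.toFun (φ₁.toFun P)
  map_join S P h := by
    have := φ₂.map_join _ _ (φ₁.map_join S P h)
    rwa [Set.image_image] at this
  map_zero := by rw [φ₁.map_zero, φ₂.map_zero]

/-- The bilinear pairing `⟨ρ, ω⟩ = Tr(ρ ωᵗ)` of `M_X` with itself. -/
def pairing {X : Type} [Fintype X] (ρ ω : Matrix X X ℂ) : ℂ := (ρ * ωᵀ).trace

/-- The projection `P_⊥` onto the annihilator of the range of `P` in the dual space. Operators on
the dual of `ℂ^X` are identified with elements of `M_X` by sending the dual of an operator `T` to
the transpose of `T`; since `P_⊥` is the dual of `1 - P`, it corresponds to `(1 - P)ᵗ`. -/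
def Proj.perp {X : Type} [Fintype X] [DecidableEq X] (P : Proj X) : Matrix X X ℂ := (1 - P.1)ᵀ

/-- `Γ` is a perfect strategy for the quantum non-local game `φ`. -/
def IsPerfect {X Y A B : Type} [Fintype X] [Fintype Y] [Fintype A] [Fintype B]
    [DecidableEq A] [DecidableEq B] (φ : Game X Y A B) (Γ : CorrMap X Y A B) : Prop :=
  IsQNS Γ ∧ ∀ P : Proj (X × Y), pairing (Γ P.1) (φ.toFun P).perp = 0

end QNG

end

open scoped ComplexOrder Matrix Kronecker TensorProduct ENNReal InnerProductSpace

noncomputable section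

namespace QNG

/-! ### Channels, no-signalling maps and perfect strategies under composition -/

/-! Perfection composes by positivity alone. Put `Q = φ₁(P)` and `R = Γ₁(P)`. Since `R ≥ 0` and
`Tr(R(1 - Q)) = 0`, `R` lives under `Q`, so `R ≤ cQ` for some scalar `c`. Applying `Γ₂` and pairing
with `T = 1 - φ₂(Q)` gives `0 ≤ Tr(Γ₂(R)T) ≤ c Tr(Γ₂(Q)T) = 0` (`trace_map_mul_eq_zero`).

For the classes, composing maps contracts the middle indices of their Choi matrices (`ofChoi_comp`).
The operator counterpart takes stochastic operator matrices `E` on `H` and `F` on `K` to the matrix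
with entries `∑_{a,a'} E_{x,x',a,a'} ⊗ F_{a,a',z,z'}` on `H ⊗ K`. It is again stochastic
(`IsStochOp.compOp`), by factoring `E` and `F` into sums of `R^* R` and `S^* S`. Applying this to
both players, with the vector `ξ ⊗ η`, settles `qc`; for `q` the tensor legs must also be
interchanged, and `qa` follows by taking limits. The class `loc` uses linearity of composition in
each factor, and `ns` uses an extension of the no-signalling condition beyond elementary tensors.

In the tracial case, GNS representations turn the traces `τ₁`, `τ₂` into stochastic operator
matrices with cyclic vectors. By the universal property, the composed matrix yields a representation
`π` of `𝒞_{X,Z}`, and the vector functional at `ξ₁ ⊗ ξ₂` induces the composed correlation. On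
polynomials in the generators this functional is `τ₁ ⊗ τ₂` after `e_{x,x',z,z'} ↦ ∑ e_{x,x',a,a'} ⊗
e_{a,a',z,z'}`, so it is a trace, by density on all of `𝒞_{X,Z}`. If the given traces factor through
finite dimensional or abelian algebras, the GNS data inherit this, and so does the closure of the
image of `π`. -/

theorem IsCP.comp {X A Z : Type} {Φ : Matrix X X ℂ →ₗ[ℂ] Matrix A A ℂ}
    {Ψ : Matrix A A ℂ →ₗ[ℂ] Matrix Z Z ℂ} (hΨ : IsCP Ψ) (hΦ : IsCP Φ) : IsCP (Ψ ∘ₗ Φ) :=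
  fun n M hM => hΨ n _ (hΦ n M hM)

theorem IsChannel.comp {X A Z : Type} [Fintype X] [Fintype A] [Fintype Z]
    {Φ : Matrix X X ℂ →ₗ[ℂ] Matrix A A ℂ} {Ψ : Matrix A A ℂ →ₗ[ℂ] Matrix Z Z ℂ}
    (hΨ : IsChannel Ψ) (hΦ : IsChannel Φ) : IsChannel (Ψ ∘ₗ Φ) :=
  ⟨hΨ.1.comp hΦ.1, fun ρ => (hΨ.2 _).trans (hΦ.2 ρ)⟩

theorem IsCP.posSemidef {X A : Type} [Finite X] [Finite A] {Φ : Matrix X X ℂ →ₗ[ℂ] Matrix A A ℂ}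
    (hΦ : IsCP Φ) {M : Matrix X X ℂ} (hM : M.PosSemidef) : (Φ M).PosSemidef := by
  have h := hΦ 1 (fun _ _ => M) (hM.submatrix Prod.snd)
  exact h.submatrix fun a => (0, a)

theorem sum_kronecker_single {A B : Type} [Fintype B] [DecidableEq B]
    (M : Matrix (A × B) (A × B) ℂ) :
    M = ∑ b, ∑ b', (Matrix.of fun a a' => M (a, b) (a', b')) ⊗ₖ Matrix.single b b' (1 : ℂ) := by
  ext ⟨a, b⟩ ⟨a', b'⟩
  simp [Matrix.sum_apply, Matrix.kroneckerMap_apply, Matrix.single_apply, ite_and]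

theorem sum_single_kronecker {A B : Type} [Fintype A] [DecidableEq A]
    (M : Matrix (A × B) (A × B) ℂ) :
    M = ∑ a, ∑ a', Matrix.single a a' (1 : ℂ) ⊗ₖ (Matrix.of fun b b' => M (a, b) (a', b')) := by
  ext ⟨a, b⟩ ⟨a', b'⟩
  simp [Matrix.sum_apply, Matrix.kroneckerMap_apply, Matrix.single_apply, ite_and]

theorem trLeft_sum {ι A B : Type} [Fintype A] (s : Finset ι) (M : ι → Matrix (A × B) (A × B) ℂ) :
    trLeft (∑ i ∈ s, M i) = ∑ i ∈ s, trLeft (M i) := by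
  ext b b'
  simp only [trLeft, Matrix.sum_apply, Matrix.of_apply]
  exact Finset.sum_comm

theorem trRight_sum {ι A B : Type} [Fintype B] (s : Finset ι) (M : ι → Matrix (A × B) (A × B) ℂ) :
    trRight (∑ i ∈ s, M i) = ∑ i ∈ s, trRight (M i) := by
  ext b b'
  simp only [trRight, Matrix.sum_apply, Matrix.of_apply]
  exact Finset.sum_comm

section comp

variable {X Y A B Z W : Type} [Fintype X] [Fintype Y] [Fintype A] [Fintype B] [Fintype Z]
  [Fintype W]

/-- The defining condition concerns elementary tensors only, but the output of a first correlation
need not be one. Expanding the second leg in matrix units writes `M` as a sum of `M_{b,b'} ⊗ e_b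
e_{b'}^*`, and the traces of the `M_{b,b'}` are the entries of `trLeft M`. -/
theorem IsQNS.trLeft_eq_zero {Γ : CorrMap X Y A B} (h : IsQNS Γ) {M : Matrix (X × Y) (X × Y) ℂ}
    (hM : trLeft M = 0) : trLeft (Γ M) = 0 := by
  classical
  rw [sum_kronecker_single M]
  simp only [map_sum, trLeft_sum]
  refine Finset.sum_eq_zero fun b _ => Finset.sum_eq_zero fun b' _ => h.left _ _ ?_
  exact congrFun (congrFun hM b) b'

theorem IsQNS.trRight_eq_zero {Γ : CorrMap X Y A B} (h : IsQNS Γ) {M : Matrix (X × Y) (X × Y) ℂ}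
    (hM : trRight M = 0) : trRight (Γ M) = 0 := by
  classical
  rw [sum_single_kronecker M]
  simp only [map_sum, trRight_sum]
  refine Finset.sum_eq_zero fun b _ => Finset.sum_eq_zero fun b' _ => h.right _ _ ?_
  exact congrFun (congrFun hM b) b'

theorem IsQNS.comp {Γ₁ : CorrMap X Y A B} {Γ₂ : CorrMap A B Z W} (h₂ : IsQNS Γ₂) (h₁ : IsQNS Γ₁) :
    IsQNS (Γ₂ ∘ₗ Γ₁) where
  channel := h₂.channel.comp h₁.channel
  left _ _ h := h₂.trLeft_eq_zero (h₁.left _ _ h)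
  right _ _ h := h₂.trRight_eq_zero (h₁.right _ _ h)

end comp

/-! ### Positive matrices supported under a projection -/

section support

variable {X : Type} [Fintype X]

theorem trace_mul_proj {P : Matrix X X ℂ} (hP : IsStarProjection P) (R : Matrix X X ℂ) :
    (R * P).trace = (Pᴴ * R * P).trace := by
  have h1 : Pᴴ = P := hP.isSelfAdjoint
  have h2 : P * P = P := hP.isIdempotentElem
  rw [h1, Matrix.mul_assoc, Matrix.trace_mul_comm P, Matrix.mul_assoc, h2]

theorem trace_mul_proj_nonneg {R P : Matrix X X ℂ} (hR : R.PosSemidef) (hP : IsStarProjection P) :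
    0 ≤ (R * P).trace := by
  rw [trace_mul_proj hP]
  exact (hR.conjTranspose_mul_mul_same P).trace_nonneg

theorem posSemidef_of_isStarProjection {P : Matrix X X ℂ} (hP : IsStarProjection P) :
    P.PosSemidef := by
  have h := Matrix.posSemidef_conjTranspose_mul_self P
  have h1 : Pᴴ = P := hP.isSelfAdjoint
  have h2 : P * P = P := hP.isIdempotentElem
  rwa [h1, h2] at h

variable [DecidableEq X]

/-- A positive matrix of trace zero vanishes, so `(1 - Q) R (1 - Q) = 0`. With `R = S^* S` this says
`S (1 - Q) = 0`, hence `R (1 - Q) = 0`; the adjoint gives the other side. -/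
theorem eq_conj_of_trace_eq_zero {R Q : Matrix X X ℂ} (hR : R.PosSemidef)
    (hQ : IsStarProjection Q) (h : (R * (1 - Q)).trace = 0) : R = Qᴴ * R * Q := by
  rw [trace_mul_proj hQ.one_sub, (hR.conjTranspose_mul_mul_same _).trace_eq_zero_iff] at h
  have hz : R * (1 - Q) = 0 := by
    obtain ⟨S, rfl⟩ : ∃ S : Matrix X X ℂ, R = Sᴴ * S := by
      open scoped MatrixOrder in
      exact CStarAlgebra.nonneg_iff_eq_star_mul_self.1 hR.nonneg
    have h' : (S * (1 - Q))ᴴ * (S * (1 - Q)) = 0 := by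
      rw [Matrix.conjTranspose_mul, ← h]
      simp only [Matrix.mul_assoc]
    rw [Matrix.conjTranspose_mul_self_eq_zero] at h'
    rw [Matrix.mul_assoc, h', Matrix.mul_zero]
  have h1 : R = R * Q := by
    rw [mul_sub, mul_one, sub_eq_zero] at hz
    exact hz
  have h2 : R = Qᴴ * R := by
    have := congrArg Matrix.conjTranspose h1
    rwa [Matrix.conjTranspose_mul, hR.isHermitian.eq] at this
  rw [← h2, ← h1]

theorem exists_smul_one_sub_posSemidef {R : Matrix X X ℂ} (hR : R.IsHermitian) :
    ∃ c : ℝ, (((c : ℂ) • (1 : Matrix X X ℂ)) - R).PosSemidef := by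
  open scoped Matrix.Norms.L2Operator MatrixOrder in
  refine ⟨‖R‖, ?_⟩
  open scoped Matrix.Norms.L2Operator MatrixOrder in
  have h : R ≤ algebraMap ℝ _ ‖R‖ := IsSelfAdjoint.le_algebraMap_norm_self (a := R) hR
  rw [Matrix.le_iff] at h
  rwa [Algebra.algebraMap_eq_smul_one, ← Complex.coe_smul] at h

/-- Compressing `c - R ≥ 0` by `Q` gives `cQ - R ≥ 0`, because `R = QRQ`. Positivity of `Γ` then
squeezes `Tr(Γ(R)T)` between `0` and `c Tr(Γ(Q)T) = 0`. -/
theorem trace_map_mul_eq_zero {Z : Type} [Fintype Z] {Γ : Matrix X X ℂ →ₗ[ℂ] Matrix Z Z ℂ}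
    (hΓ : IsCP Γ) {R Q : Matrix X X ℂ} {T : Matrix Z Z ℂ} (hQ : IsStarProjection Q)
    (hT : IsStarProjection T) (hR : R.PosSemidef) (e₁ : (R * (1 - Q)).trace = 0)
    (e₂ : (Γ Q * T).trace = 0) : (Γ R * T).trace = 0 := by
  obtain ⟨c, hc⟩ := exists_smul_one_sub_posSemidef hR.isHermitian
  have hc' := hc.conjTranspose_mul_mul_same Q
  have h1 : Qᴴ = Q := hQ.isSelfAdjoint
  have h2 : Q * Q = Q := hQ.isIdempotentElem
  rw [mul_sub, sub_mul, ← eq_conj_of_trace_eq_zero hR hQ e₁, Matrix.mul_smul, mul_one,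
    Matrix.smul_mul, h1, h2] at hc'
  have hn := trace_mul_proj_nonneg (hΓ.posSemidef hc') hT
  rw [map_sub, map_smul, sub_mul, Matrix.trace_sub, Matrix.smul_mul, Matrix.trace_smul, e₂,
    smul_zero, zero_sub] at hn
  exact le_antisymm (neg_nonneg.1 hn) (trace_mul_proj_nonneg (hΓ.posSemidef hR) hT)

end support

/-! ### Perfect strategies compose -/

section perfect

variable {X Y A B Z W : Type} [Fintype X] [Fintype Y] [Fintype A] [Fintype B] [Fintype Z]
  [Fintype W] [DecidableEq A] [DecidableEq B] [DecidableEq Z] [DecidableEq W]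

theorem IsPerfect.comp {φ₁ : Game X Y A B} {φ₂ : Game A B Z W} {Γ₁ : CorrMap X Y A B}
    {Γ₂ : CorrMap A B Z W} (h₁ : IsPerfect φ₁ Γ₁) (h₂ : IsPerfect φ₂ Γ₂) :
    IsPerfect (φ₂.comp φ₁) (Γ₂ ∘ₗ Γ₁) := by
  refine ⟨h₂.1.comp h₁.1, fun P => ?_⟩
  have e₁ := h₁.2 P
  have e₂ := h₂.2 (φ₁.toFun P)
  simp only [pairing, Proj.perp, Matrix.transpose_transpose] at e₁ e₂ ⊢
  exact trace_map_mul_eq_zero h₂.1.channel.1 (φ₁.toFun P).2 (φ₂.toFun _).2.one_sub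
    (h₁.1.channel.1.posSemidef (posSemidef_of_isStarProjection P.2)) e₁ e₂

end perfect

/-! ### Choi matrices, local and approximately quantum correlations -/

theorem ofChoi_comp {X A Z : Type} [Fintype X] [Fintype A] (c : Matrix (X × A) (X × A) ℂ)
    (d : Matrix (A × Z) (A × Z) ℂ) :
    ofChoi d ∘ₗ ofChoi c = ofChoi (Matrix.of fun i j : X × Z =>
      ∑ a, ∑ a', c (i.1, a) (j.1, a') * d (a, i.2) (a', j.2)) := by
  ext ρ z z'
  simp only [ofChoi, LinearMap.comp_apply, LinearMap.coe_mk, AddHom.coe_mk, Matrix.of_apply,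
    Finset.sum_mul, Finset.mul_sum, Finset.sum_comm (s := (Finset.univ : Finset A))
      (t := (Finset.univ : Finset X))]
  simp only [mul_assoc]

theorem eq_sum_smul_single {X : Type} [Fintype X] [DecidableEq X] (ρ : Matrix X X ℂ) :
    ρ = ∑ x, ∑ x', ρ x x' • Matrix.single x x' (1 : ℂ) := by
  ext i j
  simp [Matrix.sum_apply, Matrix.single_apply, ite_and]

theorem tensorMap_comp {X Y A B Z W : Type} [Fintype X] [Fintype Y] [Fintype A] [Fintype B]
    [DecidableEq X] [DecidableEq Y] [DecidableEq A] [DecidableEq B]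
    (Φ₁ : Matrix X X ℂ →ₗ[ℂ] Matrix A A ℂ) (Ψ₁ : Matrix Y Y ℂ →ₗ[ℂ] Matrix B B ℂ)
    (Φ₂ : Matrix A A ℂ →ₗ[ℂ] Matrix Z Z ℂ) (Ψ₂ : Matrix B B ℂ →ₗ[ℂ] Matrix W W ℂ) :
    tensorMap Φ₂ Ψ₂ ∘ₗ tensorMap Φ₁ Ψ₁ = tensorMap (Φ₂ ∘ₗ Φ₁) (Ψ₂ ∘ₗ Ψ₁) := by
  refine LinearMap.ext fun M => ?_
  rw [sum_single_kronecker M]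
  simp only [map_sum, LinearMap.comp_apply, tensorMap_kronecker]

section classes

variable {X Y A B Z W : Type} [Fintype X] [Fintype Y] [Fintype A] [Fintype B] [Fintype Z]
  [Fintype W] [DecidableEq X] [DecidableEq Y] [DecidableEq A] [DecidableEq B]

/-- Composition is linear in each factor, so preimages of the convex hull under it are convex. It is
therefore enough to let `Γ₂`, and then `Γ₁`, be a product of channels. -/
theorem IsLoc.comp {Γ₁ : CorrMap X Y A B} {Γ₂ : CorrMap A B Z W} (h₂ : IsLoc Γ₂) (h₁ : IsLoc Γ₁) :
    IsLoc (Γ₂ ∘ₗ Γ₁) := by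
  refine ⟨h₂.1.comp h₁.1, ?_⟩
  refine convexHull_min (t := {Γ : CorrMap A B Z W | Γ ∘ₗ Γ₁ ∈ convexHull ℝ _}) ?_ ?_ h₂.2
  · rintro _ ⟨Φ₂, Ψ₂, hΦ₂, hΨ₂, rfl⟩
    refine convexHull_min
      (t := {Γ : CorrMap X Y A B | tensorMap Φ₂ Ψ₂ ∘ₗ Γ ∈ convexHull ℝ _}) ?_ ?_ h₁.2
    · rintro _ ⟨Φ₁, Ψ₁, hΦ₁, hΨ₁, rfl⟩
      exact subset_convexHull _ _ ⟨_, _, hΦ₂.comp hΦ₁, hΨ₂.comp hΨ₁, tensorMap_comp _ _ _ _⟩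
    · refine (convex_convexHull ℝ _).is_linear_preimage ⟨fun _ _ => LinearMap.comp_add _ _ _, ?_⟩
      intro c Γ
      ext
      simp
  · refine (convex_convexHull ℝ _).is_linear_preimage ⟨fun _ _ => LinearMap.add_comp _ _ _, ?_⟩
    intro c Γ
    rfl

/-- Both the maps and their arguments vary with `n`. Expanding the argument in matrix units leaves a
finite sum of products of convergent scalars and convergent matrices. -/
theorem IsQA.comp
    (hq : ∀ (Γ₁ : CorrMap X Y A B) (Γ₂ : CorrMap A B Z W), IsQ Γ₂ → IsQ Γ₁ → IsQ (Γ₂ ∘ₗ Γ₁))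
    {Γ₁ : CorrMap X Y A B} {Γ₂ : CorrMap A B Z W} (h₂ : IsQA Γ₂) (h₁ : IsQA Γ₁) :
    IsQA (Γ₂ ∘ₗ Γ₁) := by
  obtain ⟨n₁, Γs₁, q₁, t₁⟩ := h₁
  obtain ⟨n₂, Γs₂, q₂, t₂⟩ := h₂
  refine ⟨n₂.comp n₁, fun n => Γs₂ n ∘ₗ Γs₁ n, fun n => hq _ _ (q₂ n) (q₁ n), fun ρ => ?_⟩
  have key : ∀ (Γ : CorrMap A B Z W) (σ : Matrix (A × B) (A × B) ℂ),
      Γ σ = ∑ i, ∑ j, σ i j • Γ (Matrix.single i j 1) := fun Γ σ => by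
    conv_lhs => rw [eq_sum_smul_single σ]
    simp only [map_sum, map_smul]
  rw [LinearMap.comp_apply, key Γ₂,
    show (fun n => (Γs₂ n ∘ₗ Γs₁ n) ρ) = fun n => ∑ i, ∑ j, Γs₁ n ρ i j •
      Γs₂ n (Matrix.single i j 1) from funext fun n => key _ _]
  refine tendsto_finsetSum _ fun i _ => tendsto_finsetSum _ fun j _ => ?_
  refine Filter.Tendsto.smul ?_ (t₂ _)
  exact ((continuous_apply_apply i j).tendsto _).comp (t₁ ρ)

end classes

/-! ### Factorization of positive operator matrices -/

section factor

theorem exists_eq_star_mul_self_of_nonneg {G : Type} [NormedAddCommGroup G]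
    [InnerProductSpace ℂ G] [CompleteSpace G] {T : G →L[ℂ] G} (hT : ∀ x, 0 ≤ ⟪x, T x⟫_ℂ) :
    ∃ S : G →L[ℂ] G, T = S.adjoint ∘L S := by
  refine CStarAlgebra.nonneg_iff_eq_star_mul_self.1 ?_
  rw [ContinuousLinearMap.nonneg_iff_isPositive, ContinuousLinearMap.isPositive_iff_complex]
  intro x
  have h := Complex.nonneg_iff.1 (hT x)
  have h' : ⟪T x, x⟫_ℂ = ⟪x, T x⟫_ℂ := by
    rw [← inner_conj_symm]
    exact Complex.conj_eq_iff_im.2 h.2.symm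
  rw [h']
  exact ⟨Complex.ext rfl h.2, h.1⟩

variable {n H : Type} [NormedAddCommGroup H] [InnerProductSpace ℂ H]

variable (H) in
/-- The coordinate projections of the Hilbert space direct sum of copies of `H`. -/
def coord (k : n) : PiLp 2 (fun _ : n => H) →L[ℂ] H := PiLp.proj 2 (fun _ : n => H) k

theorem coord_apply (k : n) (x : PiLp 2 (fun _ : n => H)) : coord H k x = x k := rfl

variable [Fintype n]

theorem inner_eq_sum_coord (x y : PiLp 2 (fun _ : n => H)) :
    ⟪x, y⟫_ℂ = ∑ k, ⟪coord H k x, coord H k y⟫_ℂ := PiLp.inner_apply _ _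

variable [CompleteSpace H]

theorem sum_adjoint_coord_comp_coord :
    ∑ k : n, (coord H k).adjoint ∘L coord H k = ContinuousLinearMap.id ℂ _ := by
  ext1 x
  refine ext_inner_left ℂ fun y => ?_
  simp only [_root_.sum_apply, inner_sum, ContinuousLinearMap.comp_apply,
    ContinuousLinearMap.adjoint_inner_right]
  exact (inner_eq_sum_coord _ _).symm

theorem coord_adjoint_coord [DecidableEq n] (i j : n) (x : H) :
    coord H i ((coord H j).adjoint x) = if i = j then x else 0 := by
  have h : (coord H j).adjoint x = PiLp.single 2 j x := by
    refine ext_inner_right ℂ fun y => ?_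
    rw [ContinuousLinearMap.adjoint_inner_left, inner_eq_sum_coord, Finset.sum_eq_single j]
    · simp [coord_apply]
    · intro k _ hk
      simp [coord_apply, hk]
    · simp
  rw [h, coord_apply]
  by_cases hij : i = j
  · subst hij; simp
  · simp [hij]

/-- A positive operator matrix is of the form `(V_i^* V_j)`. -/
theorem exists_adjoint_comp_eq {P : Matrix n n (H →L[ℂ] H)}
    (hP : ∀ ξ : n → H, 0 ≤ ∑ i, ∑ j, ⟪ξ i, P i j (ξ j)⟫_ℂ) :
    ∃ V : n → H →L[ℂ] PiLp 2 (fun _ : n => H), ∀ i j, P i j = (V i).adjoint ∘L V j := by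
  classical
  -- The operator on the direct sum with block matrix `P`. Once `T = S^* S`, the operator `V_i` is
  -- `S` on the `i`-th copy of `H`.
  let T : PiLp 2 (fun _ : n => H) →L[ℂ] PiLp 2 (fun _ : n => H) :=
    ∑ i, ∑ j, (coord H i).adjoint ∘L P i j ∘L coord H j
  have hT : ∀ x, T x = ∑ i, ∑ j, (coord H i).adjoint (P i j (coord H j x)) := fun x => by
    simp [T, _root_.sum_apply]
  obtain ⟨S, hS⟩ := exists_eq_star_mul_self_of_nonneg (T := T) fun x => by
    simpa only [hT, inner_sum, ContinuousLinearMap.adjoint_inner_right]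
      using hP fun i => coord H i x
  refine ⟨fun i => S ∘L (coord H i).adjoint, fun i j => ?_⟩
  have e : (S ∘L (coord H i).adjoint).adjoint ∘L (S ∘L (coord H j).adjoint) =
      coord H i ∘L T ∘L (coord H j).adjoint := by
    rw [hS, ContinuousLinearMap.adjoint_comp, ContinuousLinearMap.adjoint_adjoint]
    rfl
  rw [e]
  ext1 v
  simp [hT, coord_adjoint_coord, apply_ite (P _ _)]

/-- A positive operator matrix is of the form `(∑_k R_{k,i}^* R_{k,j})`. -/
theorem exists_sum_star_mul_eq {P : Matrix n n (H →L[ℂ] H)}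
    (hP : ∀ ξ : n → H, 0 ≤ ∑ i, ∑ j, ⟪ξ i, P i j (ξ j)⟫_ℂ) :
    ∃ R : n → n → H →L[ℂ] H, ∀ i j, P i j = ∑ k, star (R k i) * R k j := by
  obtain ⟨V, hV⟩ := exists_adjoint_comp_eq hP
  -- Cutting the target of `V_i` into coordinates makes all factors operators on `H` itself, so that
  -- representations of the operators on `H` can be applied to them.
  refine ⟨fun k i => coord H k ∘L V i, fun i j => ?_⟩
  have h : ∀ k, star (coord H k ∘L V i) * (coord H k ∘L V j) =
      (V i).adjoint ∘L ((coord H k).adjoint ∘L coord H k) ∘L V j := by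
    intro k
    rw [ContinuousLinearMap.star_eq_adjoint, ContinuousLinearMap.adjoint_comp]
    rfl
  simp only [h]
  rw [← ContinuousLinearMap.comp_finsetSum, ← ContinuousLinearMap.finsetSum_comp,
    sum_adjoint_coord_comp_coord, hV]
  rfl

end factor

/-! ### The tensor product of Hilbert spaces and amplifications of operators -/

section tensor

open UniformSpace

/-- The Hilbert space tensor product. -/
def HilbertTensor (H K : Type) [NormedAddCommGroup H] [InnerProductSpace ℂ H]
    [NormedAddCommGroup K] [InnerProductSpace ℂ K] : Type := Completion (H ⊗[ℂ] K)

variable {H K : Type} [NormedAddCommGroup H] [InnerProductSpace ℂ H]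
  [NormedAddCommGroup K] [InnerProductSpace ℂ K]

instance : NormedAddCommGroup (HilbertTensor H K) :=
  inferInstanceAs (NormedAddCommGroup (Completion (H ⊗[ℂ] K)))

instance : InnerProductSpace ℂ (HilbertTensor H K) :=
  inferInstanceAs (InnerProductSpace ℂ (Completion (H ⊗[ℂ] K)))

instance : CompleteSpace (HilbertTensor H K) :=
  inferInstanceAs (CompleteSpace (Completion (H ⊗[ℂ] K)))

/-- The isometric embedding of the algebraic tensor product. -/
def HilbertTensor.incl : H ⊗[ℂ] K →ₗᵢ[ℂ] HilbertTensor H K :=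
  Completion.toComplₗᵢ (𝕜 := ℂ) (E := H ⊗[ℂ] K)

theorem HilbertTensor.denseRange_incl :
    DenseRange (HilbertTensor.incl : H ⊗[ℂ] K →ₗᵢ[ℂ] HilbertTensor H K) :=
  Completion.denseRange_coe

/-- The extension of a bounded operator from the algebraic tensor product. -/
def HilbertTensor.extend (T : H ⊗[ℂ] K →L[ℂ] H ⊗[ℂ] K) :
    HilbertTensor H K →L[ℂ] HilbertTensor H K :=
  T.completion

theorem HilbertTensor.extend_incl (T : H ⊗[ℂ] K →L[ℂ] H ⊗[ℂ] K) (u : H ⊗[ℂ] K) :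
    HilbertTensor.extend T (.incl u) = .incl (T u) :=
  T.completion_apply_coe u

/-- The elementary tensor `h ⊗ k`. -/
def HilbertTensor.tmul (h : H) (k : K) : HilbertTensor H K := .incl (h ⊗ₜ[ℂ] k)

theorem HilbertTensor.inner_tmul (h h' : H) (k k' : K) :
    ⟪HilbertTensor.tmul h k, HilbertTensor.tmul h' k'⟫_ℂ = ⟪h, h'⟫_ℂ * ⟪k, k'⟫_ℂ := by
  simp [HilbertTensor.tmul]

theorem HilbertTensor.norm_tmul (h : H) (k : K) : ‖HilbertTensor.tmul h k‖ = ‖h‖ * ‖k‖ := by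
  simp [HilbertTensor.tmul]

/-- Density of the algebraic tensor product reduces every identity between amplifications to
elementary tensors. -/
theorem HilbertTensor.clm_ext {G : Type} [NormedAddCommGroup G] [NormedSpace ℂ G]
    {S T : HilbertTensor H K →L[ℂ] G} (h : ∀ x y, S (.tmul x y) = T (.tmul x y)) : S = T := by
  refine ContinuousLinearMap.coeFn_injective
    (denseRange_incl.equalizer S.continuous T.continuous (funext fun u => ?_))
  simp only [Function.comp_apply]
  induction u using TensorProduct.induction_on with
  | zero => simp
  | tmul x y => exact h x y
  | add x y hx hy => rw [map_add, map_add, map_add, hx, hy]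

theorem HilbertTensor.eq_adjoint {S T : HilbertTensor H K →L[ℂ] HilbertTensor H K}
    (h : ∀ x y x' y', ⟪S (.tmul x y), .tmul x' y'⟫_ℂ =
      ⟪HilbertTensor.tmul x y, T (.tmul x' y')⟫_ℂ) : S = T.adjoint := by
  refine clm_ext fun x y => ext_inner_right ℂ fun v => ?_
  have : innerSL ℂ (S (.tmul x y)) = innerSL ℂ (T.adjoint (.tmul x y)) := by
    refine clm_ext fun x' y' => ?_
    simpa [ContinuousLinearMap.adjoint_inner_left] using h x y x' y'
  exact congrArg (fun f : HilbertTensor H K →L[ℂ] ℂ => f v) this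

theorem HilbertTensor.extend_rTensor_tmul (T : H →L[ℂ] H) (x : H) (y : K) :
    HilbertTensor.extend (T.rTensor K) (.tmul x y) = .tmul (T x) y :=
  HilbertTensor.extend_incl _ _

theorem HilbertTensor.extend_lTensor_tmul (T : K →L[ℂ] K) (x : H) (y : K) :
    HilbertTensor.extend (T.lTensor H) (.tmul x y) = .tmul x (T y) :=
  HilbertTensor.extend_incl _ _

variable [CompleteSpace H] [CompleteSpace K]

variable (K) in
/-- The amplification `T ↦ T ⊗ 1`. -/
def ampLeft : (H →L[ℂ] H) →⋆ₐ[ℂ] (HilbertTensor H K →L[ℂ] HilbertTensor H K) where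
  toFun T := HilbertTensor.extend (T.rTensor K)
  map_one' := HilbertTensor.clm_ext fun x y => HilbertTensor.extend_rTensor_tmul _ _ _
  map_mul' S T := HilbertTensor.clm_ext fun x y => by simp [HilbertTensor.extend_rTensor_tmul]
  map_zero' := HilbertTensor.clm_ext fun x y => by
    rw [HilbertTensor.extend_rTensor_tmul]
    simp [HilbertTensor.tmul]
  map_add' S T := HilbertTensor.clm_ext fun x y => by
    rw [_root_.add_apply, HilbertTensor.extend_rTensor_tmul, HilbertTensor.extend_rTensor_tmul, HilbertTensor.extend_rTensor_tmul]
    simp [HilbertTensor.tmul, TensorProduct.add_tmul]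
  commutes' c := HilbertTensor.clm_ext fun x y => by
    rw [HilbertTensor.extend_rTensor_tmul]
    simp [HilbertTensor.tmul, Algebra.algebraMap_eq_smul_one, ← TensorProduct.smul_tmul']
  map_star' T := HilbertTensor.eq_adjoint fun x y x' y' => by
    simp [HilbertTensor.extend_rTensor_tmul, HilbertTensor.inner_tmul,
      ContinuousLinearMap.star_eq_adjoint, ContinuousLinearMap.adjoint_inner_left]

variable (H) in
/-- The amplification `T ↦ 1 ⊗ T`. -/
def ampRight : (K →L[ℂ] K) →⋆ₐ[ℂ] (HilbertTensor H K →L[ℂ] HilbertTensor H K) where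
  toFun T := HilbertTensor.extend (T.lTensor H)
  map_one' := HilbertTensor.clm_ext fun x y => HilbertTensor.extend_lTensor_tmul _ _ _
  map_mul' S T := HilbertTensor.clm_ext fun x y => by simp [HilbertTensor.extend_lTensor_tmul]
  map_zero' := HilbertTensor.clm_ext fun x y => by
    rw [HilbertTensor.extend_lTensor_tmul]
    simp [HilbertTensor.tmul]
  map_add' S T := HilbertTensor.clm_ext fun x y => by
    rw [_root_.add_apply, HilbertTensor.extend_lTensor_tmul, HilbertTensor.extend_lTensor_tmul, HilbertTensor.extend_lTensor_tmul]
    simp [HilbertTensor.tmul, TensorProduct.tmul_add]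
  commutes' c := HilbertTensor.clm_ext fun x y => by
    rw [HilbertTensor.extend_lTensor_tmul]
    simp [HilbertTensor.tmul, Algebra.algebraMap_eq_smul_one]
  map_star' T := HilbertTensor.eq_adjoint fun x y x' y' => by
    simp [HilbertTensor.extend_lTensor_tmul, HilbertTensor.inner_tmul,
      ContinuousLinearMap.star_eq_adjoint, ContinuousLinearMap.adjoint_inner_left]

omit [CompleteSpace K] in
@[simp]
theorem ampLeft_tmul (T : H →L[ℂ] H) (x : H) (y : K) :
    ampLeft K T (.tmul x y) = .tmul (T x) y :=
  HilbertTensor.extend_rTensor_tmul T x y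

omit [CompleteSpace H] in
@[simp]
theorem ampRight_tmul (T : K →L[ℂ] K) (x : H) (y : K) :
    ampRight H T (.tmul x y) = .tmul x (T y) :=
  HilbertTensor.extend_lTensor_tmul T x y

theorem commute_ampLeft_ampRight (S : H →L[ℂ] H) (T : K →L[ℂ] K) :
    Commute (ampLeft K S) (ampRight H T) :=
  HilbertTensor.clm_ext fun x y => by simp

/-- The range is a finite dimensional subspace, hence closed, and being dense it is everything. This
serves both completed tensor products and GNS spaces. -/
theorem finiteDimensional_of_denseRange {V G : Type} [AddCommGroup V] [Module ℂ V]
    [FiniteDimensional ℂ V] [NormedAddCommGroup G] [NormedSpace ℂ G] (f : V →ₗ[ℂ] G)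
    (hf : DenseRange f) : FiniteDimensional ℂ G := by
  have hc : IsClosed (LinearMap.range f : Set G) := Submodule.closed_of_finiteDimensional _
  have : LinearMap.range f = ⊤ := by
    refine SetLike.coe_injective ?_
    rw [← hc.closure_eq]
    exact hf.closure_eq
  exact Module.Finite.of_surjective f (LinearMap.range_eq_top.1 this)

instance [FiniteDimensional ℂ H] [FiniteDimensional ℂ K] :
    FiniteDimensional ℂ (HilbertTensor H K) :=
  finiteDimensional_of_denseRange HilbertTensor.incl.toLinearMap HilbertTensor.denseRange_incl

end tensor

/-! ### Composition of stochastic operator matrices -/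

section compOp

theorem sum_inner_sum {ι A κ G : Type} [Fintype ι] [Fintype A] [Fintype κ] [NormedAddCommGroup G]
    [InnerProductSpace ℂ G] (f : κ → ι → A → G) :
    ∑ i, ∑ j, ∑ a, ∑ a', ∑ k, ⟪f k i a, f k j a'⟫_ℂ =
      ∑ k, ⟪∑ i, ∑ a, f k i a, ∑ i, ∑ a, f k i a⟫_ℂ := by
  have h : ∀ k, ⟪∑ i, ∑ a, f k i a, ∑ i, ∑ a, f k i a⟫_ℂ =
      ∑ i, ∑ j, ∑ a, ∑ a', ⟪f k i a, f k j a'⟫_ℂ := fun k => by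
    rw [sum_inner]
    refine Finset.sum_congr rfl fun i _ => ?_
    rw [inner_sum]
    refine Finset.sum_congr rfl fun j _ => ?_
    rw [sum_inner]
    exact Finset.sum_congr rfl fun a _ => inner_sum _ _ _
  simp only [h]
  rw [Finset.sum_comm (s := (Finset.univ : Finset κ))]
  refine Finset.sum_congr rfl fun i _ => ?_
  rw [Finset.sum_comm (s := (Finset.univ : Finset κ))]
  refine Finset.sum_congr rfl fun j _ => ?_
  rw [Finset.sum_comm (s := (Finset.univ : Finset κ))]
  refine Finset.sum_congr rfl fun a _ => ?_
  rw [Finset.sum_comm (s := (Finset.univ : Finset κ))]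

variable {X A Z H K G : Type} [Fintype X] [Fintype A] [Fintype Z]
  [NormedAddCommGroup H] [InnerProductSpace ℂ H] [CompleteSpace H]
  [NormedAddCommGroup K] [InnerProductSpace ℂ K] [CompleteSpace K]
  [NormedAddCommGroup G] [InnerProductSpace ℂ G] [CompleteSpace G]

/-- The composition `(∑_{a,a'} l(E_{x,x',a,a'}) r(F_{a,a',z,z'}))` of operator matrices, relative
to representations `l` and `r` of the operators on a common space. -/
def compOp (l : (H →L[ℂ] H) →⋆ₐ[ℂ] (G →L[ℂ] G)) (r : (K →L[ℂ] K) →⋆ₐ[ℂ] (G →L[ℂ] G))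
    (E : Matrix (X × A) (X × A) (H →L[ℂ] H)) (F : Matrix (A × Z) (A × Z) (K →L[ℂ] K)) :
    Matrix (X × Z) (X × Z) (G →L[ℂ] G) :=
  fun i j => ∑ a, ∑ a', l (E (i.1, a) (j.1, a')) * r (F (a, i.2) (a', j.2))

/-- Factor `E` and `F` as sums of `R^* R` and `S^* S`. Since `l` and `r` commute, each summand
becomes `T^* T` with `T = l(R) r(S)`, and the quadratic form is a sum of squared norms. For the
trace, summing `F` over `z` forces `a = a'`, and what remains is the partial trace of `E`. -/
theorem IsStochOp.compOp [DecidableEq X] [DecidableEq A]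
    {l : (H →L[ℂ] H) →⋆ₐ[ℂ] (G →L[ℂ] G)} {r : (K →L[ℂ] K) →⋆ₐ[ℂ] (G →L[ℂ] G)}
    (hc : ∀ S T, Commute (l S) (r T))
    {E : Matrix (X × A) (X × A) (H →L[ℂ] H)} {F : Matrix (A × Z) (A × Z) (K →L[ℂ] K)}
    (hE : IsStochOp E) (hF : IsStochOp F) : IsStochOp (compOp l r E F) where
  pos ξ := by
    obtain ⟨R, hR⟩ := exists_sum_star_mul_eq hE.pos
    obtain ⟨S, hS⟩ := exists_sum_star_mul_eq hF.pos
    let T : (X × A) × (A × Z) → X × Z → A → G →L[ℂ] G := fun k i a =>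
      l (R k.1 (i.1, a)) * r (S k.2 (a, i.2))
    have key : ∀ (i j : X × Z) a a', l (E (i.1, a) (j.1, a')) * r (F (a, i.2) (a', j.2))
        = ∑ k, star (T k i a) * T k j a' := by
      intro i j a a'
      rw [hR, hS, map_sum, map_sum, Finset.sum_mul_sum,
        Fintype.sum_prod_type (f := fun k => star (T k i a) * T k j a')]
      refine Finset.sum_congr rfl fun k _ => Finset.sum_congr rfl fun m _ => ?_
      simp only [T]
      rw [star_mul, ← map_star, ← map_star, mul_assoc, ← mul_assoc (l _) (l _), ← map_mul,
        ← mul_assoc (r _), ← (hc _ _).eq, mul_assoc, ← map_mul]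
    have h : ∑ i, ∑ j, ⟪ξ i, QNG.compOp l r E F i j (ξ j)⟫_ℂ = ∑ i, ∑ j, ∑ a, ∑ a', ∑ k,
        ⟪T k i a (ξ i), T k j a' (ξ j)⟫_ℂ := by
      simp only [QNG.compOp, key, _root_.sum_apply, inner_sum, mul_apply_eq_comp,
        ContinuousLinearMap.star_eq_adjoint, ContinuousLinearMap.adjoint_inner_right]
    rw [h, sum_inner_sum fun k i a => T k i a (ξ i)]
    refine Finset.sum_nonneg fun k _ => ?_
    rw [inner_self_eq_norm_sq_to_K]
    positivity
  trace x x' := by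
    simp only [QNG.compOp]
    calc _ = ∑ a, ∑ a', l (E (x, a) (x', a')) * r (∑ z, F (a, z) (a', z)) := by
          rw [Finset.sum_comm]
          refine Finset.sum_congr rfl fun a _ => ?_
          rw [Finset.sum_comm]
          simp only [map_sum, Finset.mul_sum]
      _ = ∑ a, l (E (x, a) (x', a)) := by
          refine Finset.sum_congr rfl fun a _ => ?_
          simp [hF.trace, apply_ite r]
      _ = _ := by
          rw [← map_sum, hE.trace]
          split_ifs <;> simp

/-- The two legs separate on an elementary tensor. Hence the vector coefficients are sums of
products of the original coefficients, in the commuting and in the tracial case alike. -/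
theorem compOp_mul_compOp_apply_tmul {X A Y B Z W H K : Type} [Fintype A] [Fintype B]
    [NormedAddCommGroup H] [InnerProductSpace ℂ H] [CompleteSpace H]
    [NormedAddCommGroup K] [InnerProductSpace ℂ K] [CompleteSpace K]
    (E₁ : Matrix (X × A) (X × A) (H →L[ℂ] H)) (E₂ : Matrix (A × Z) (A × Z) (K →L[ℂ] K))
    (F₁ : Matrix (Y × B) (Y × B) (H →L[ℂ] H)) (F₂ : Matrix (B × W) (B × W) (K →L[ℂ] K))
    (i i' : X × Z) (j j' : Y × W) (ξ : H) (η : K) :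
    (compOp (ampLeft K) (ampRight H) E₁ E₂ i i' * compOp (ampLeft K) (ampRight H) F₁ F₂ j j')
      (.tmul ξ η) = ∑ p : A × B, ∑ p' : A × B,
        HilbertTensor.tmul ((E₁ (i.1, p.1) (i'.1, p'.1) * F₁ (j.1, p.2) (j'.1, p'.2)) ξ)
          ((E₂ (p.1, i.2) (p'.1, i'.2) * F₂ (p.2, j.2) (p'.2, j'.2)) η) := by
  simp only [compOp, Fintype.sum_prod_type, Finset.sum_mul_sum]
  simp only [_root_.sum_apply]
  refine Finset.sum_congr rfl fun a _ => Finset.sum_congr rfl fun b _ =>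
    Finset.sum_congr rfl fun a' _ => Finset.sum_congr rfl fun b' _ => ?_
  simp

end compOp

/-! ### Composition of quantum commuting and of quantum correlations -/

section classes

variable {X Y A B Z W : Type} [Fintype X] [Fintype Y] [Fintype A] [Fintype B] [Fintype Z]
  [Fintype W] [DecidableEq X] [DecidableEq Y] [DecidableEq A] [DecidableEq B]

theorem stateMap_comp_stateMap {X A Z H K G : Type} [Fintype X] [Fintype A]
    [NormedAddCommGroup H] [InnerProductSpace ℂ H] [NormedAddCommGroup K] [InnerProductSpace ℂ K]
    [NormedAddCommGroup G] [InnerProductSpace ℂ G]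
    {S : Matrix (X × A) (X × A) (H →L[ℂ] H)} {T : Matrix (A × Z) (A × Z) (K →L[ℂ] K)}
    {R : Matrix (X × Z) (X × Z) (G →L[ℂ] G)} {ξ : H} {η : K} {ζ : G}
    (h : ∀ i j, ⟪ζ, R i j ζ⟫_ℂ =
      ∑ a, ∑ a', ⟪ξ, S (i.1, a) (j.1, a') ξ⟫_ℂ * ⟪η, T (a, i.2) (a', j.2) η⟫_ℂ) :
    stateMap T η ∘ₗ stateMap S ξ = stateMap R ζ :=
  (ofChoi_comp _ _).trans (congrArg ofChoi (Matrix.ext fun i j => (h i j).symm))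

theorem map_sum_sum {A B M N : Type} [Fintype A] [Fintype B] [AddCommGroup M] [Module ℂ M]
    [AddCommGroup N] [Module ℂ N] (f : A → A → M →ₗ[ℂ] M) (g : B → B → N →ₗ[ℂ] N) :
    TensorProduct.map (∑ a, ∑ a', f a a') (∑ b, ∑ b', g b b') =
      ∑ p : A × B, ∑ p' : A × B, TensorProduct.map (f p.1 p'.1) (g p.2 p'.2) := by
  rw [← TensorProduct.mapBilinear_apply]
  simp only [Fintype.sum_prod_type, map_sum, LinearMap.sum_apply, TensorProduct.mapBilinear_apply]
  conv_rhs => rw [Finset.sum_comm]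
  refine Finset.sum_congr rfl fun b _ => ?_
  rw [Finset.sum_comm]
  conv_rhs =>
    enter [2, a]
    rw [Finset.sum_comm]

omit [DecidableEq A] [DecidableEq B] in
theorem commute_compOp {X Z Y W H K G : Type}
    [NormedAddCommGroup H] [InnerProductSpace ℂ H] [CompleteSpace H]
    [NormedAddCommGroup K] [InnerProductSpace ℂ K] [CompleteSpace K]
    [NormedAddCommGroup G] [InnerProductSpace ℂ G] [CompleteSpace G]
    {l : (H →L[ℂ] H) →⋆ₐ[ℂ] (G →L[ℂ] G)} {r : (K →L[ℂ] K) →⋆ₐ[ℂ] (G →L[ℂ] G)}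
    (hc : ∀ S T, Commute (l S) (r T))
    {E₁ : Matrix (X × A) (X × A) (H →L[ℂ] H)} {E₂ : Matrix (A × Z) (A × Z) (K →L[ℂ] K)}
    {F₁ : Matrix (Y × B) (Y × B) (H →L[ℂ] H)} {F₂ : Matrix (B × W) (B × W) (K →L[ℂ] K)}
    (h₁ : ∀ i j k m, Commute (E₁ i j) (F₁ k m)) (h₂ : ∀ i j k m, Commute (E₂ i j) (F₂ k m))
    (i j : X × Z) (k m : Y × W) : Commute (compOp l r E₁ E₂ i j) (compOp l r F₁ F₂ k m) := by
  refine Commute.sum_left _ _ _ fun a _ => Commute.sum_left _ _ _ fun a' _ =>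
    Commute.sum_right _ _ _ fun b _ => Commute.sum_right _ _ _ fun b' _ => ?_
  exact (((h₁ _ _ _ _).map l).mul_right (hc _ _)).mul_left
    ((hc _ _).symm.mul_right ((h₂ _ _ _ _).map r))

theorem IsQC.comp {Γ₁ : CorrMap X Y A B} {Γ₂ : CorrMap A B Z W} (h₂ : IsQC Γ₂) (h₁ : IsQC Γ₁) :
    IsQC (Γ₂ ∘ₗ Γ₁) := by
  refine ⟨h₂.1.comp h₁.1, ?_⟩
  obtain ⟨-, H, _, _, _, E₁, F₁, ξ, hE₁, hF₁, hc₁, hξ, rfl⟩ := h₁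
  obtain ⟨-, K, _, _, _, E₂, F₂, η, hE₂, hF₂, hc₂, hη, rfl⟩ := h₂
  refine ⟨HilbertTensor H K, inferInstance, inferInstance, inferInstance,
    compOp (ampLeft K) (ampRight H) E₁ E₂, compOp (ampLeft K) (ampRight H) F₁ F₂, .tmul ξ η,
    hE₁.compOp commute_ampLeft_ampRight hE₂, hF₁.compOp commute_ampLeft_ampRight hF₂,
    commute_compOp commute_ampLeft_ampRight hc₁ hc₂, ?_, ?_⟩
  · rw [HilbertTensor.norm_tmul, hξ, hη, one_mul]
  · refine stateMap_comp_stateMap fun i j => ?_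
    rw [dotOp, compOp_mul_compOp_apply_tmul]
    simp only [inner_sum, HilbertTensor.inner_tmul, dotOp]

/-- The canonical embedding of `(H₁ ⊗ K₁) ⊗ (H₂ ⊗ K₂)` into `(H₁ ⊗ H₂) ⊗ (K₁ ⊗ K₂)`. -/
def tensorShuffle (H₁ H₂ K₁ K₂ : Type) [NormedAddCommGroup H₁] [InnerProductSpace ℂ H₁]
    [NormedAddCommGroup H₂] [InnerProductSpace ℂ H₂] [NormedAddCommGroup K₁]
    [InnerProductSpace ℂ K₁] [NormedAddCommGroup K₂] [InnerProductSpace ℂ K₂] :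
    (H₁ ⊗[ℂ] K₁) ⊗[ℂ] (H₂ ⊗[ℂ] K₂) →ₗ[ℂ] HilbertTensor H₁ H₂ ⊗[ℂ] HilbertTensor K₁ K₂ :=
  TensorProduct.map HilbertTensor.incl.toLinearMap HilbertTensor.incl.toLinearMap ∘ₗ
    (TensorProduct.tensorTensorTensorComm ℂ H₁ K₁ H₂ K₂).toLinearMap

/-! ### Interchanging the middle tensor legs -/

section shuffle

variable {H₁ H₂ K₁ K₂ : Type} [NormedAddCommGroup H₁] [InnerProductSpace ℂ H₁]
  [NormedAddCommGroup H₂] [InnerProductSpace ℂ H₂] [NormedAddCommGroup K₁]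
  [InnerProductSpace ℂ K₁] [NormedAddCommGroup K₂] [InnerProductSpace ℂ K₂]

theorem tensorShuffle_tmul (h₁ : H₁) (h₂ : H₂) (k₁ : K₁) (k₂ : K₂) :
    tensorShuffle H₁ H₂ K₁ K₂ ((h₁ ⊗ₜ k₁) ⊗ₜ (h₂ ⊗ₜ k₂)) =
      HilbertTensor.tmul h₁ h₂ ⊗ₜ HilbertTensor.tmul k₁ k₂ := by
  simp [tensorShuffle, HilbertTensor.tmul]

/-- For elementary tensors both sides are the product of the same four inner products;
sesquilinearity does the rest. -/
theorem inner_tensorShuffle (u u' : H₁ ⊗[ℂ] K₁) (v v' : H₂ ⊗[ℂ] K₂) :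
    ⟪tensorShuffle H₁ H₂ K₁ K₂ (u ⊗ₜ v), tensorShuffle H₁ H₂ K₁ K₂ (u' ⊗ₜ v')⟫_ℂ =
      ⟪u, u'⟫_ℂ * ⟪v, v'⟫_ℂ := by
  induction u using TensorProduct.induction_on with
  | zero => simp
  | add u₁ u₂ h₁ h₂ =>
    rw [TensorProduct.add_tmul, map_add, inner_add_left, h₁, h₂, inner_add_left, add_mul]
  | tmul x y =>
  induction v using TensorProduct.induction_on with
  | zero => simp
  | add u₁ u₂ h₁ h₂ =>
    rw [TensorProduct.tmul_add, map_add, inner_add_left, h₁, h₂, inner_add_left, mul_add]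
  | tmul z w =>
  induction u' using TensorProduct.induction_on with
  | zero => simp
  | add u₁ u₂ h₁ h₂ =>
    rw [TensorProduct.add_tmul, map_add, inner_add_right, h₁, h₂, inner_add_right, add_mul]
  | tmul x' y' =>
  induction v' using TensorProduct.induction_on with
  | zero => simp
  | add u₁ u₂ h₁ h₂ =>
    rw [TensorProduct.tmul_add, map_add, inner_add_right, h₁, h₂, inner_add_right, mul_add]
  | tmul z' w' =>
    simp only [tensorShuffle_tmul, TensorProduct.inner_tmul, HilbertTensor.inner_tmul]
    ring

variable [CompleteSpace H₁] [CompleteSpace H₂] [CompleteSpace K₁] [CompleteSpace K₂]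

/-- The joint state lives in `(H₁ ⊗ K₁) ⊗ (H₂ ⊗ K₂)`, while the players act on `H₁ ⊗ H₂` and `K₁ ⊗
K₂`. The shuffle carries one picture to the other. -/
theorem map_tensorShuffle (S₁ : H₁ →L[ℂ] H₁) (S₂ : H₂ →L[ℂ] H₂) (T₁ : K₁ →L[ℂ] K₁)
    (T₂ : K₂ →L[ℂ] K₂) (u : H₁ ⊗[ℂ] K₁) (v : H₂ ⊗[ℂ] K₂) :
    TensorProduct.map
      ((ampLeft H₂ S₁ * ampRight H₁ S₂ : HilbertTensor H₁ H₂ →L[ℂ] _) : _ →ₗ[ℂ] _)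
      ((ampLeft K₂ T₁ * ampRight K₁ T₂ : HilbertTensor K₁ K₂ →L[ℂ] _) : _ →ₗ[ℂ] _)
      (tensorShuffle H₁ H₂ K₁ K₂ (u ⊗ₜ v)) =
    tensorShuffle H₁ H₂ K₁ K₂
      (TensorProduct.map (S₁ : H₁ →ₗ[ℂ] H₁) (T₁ : K₁ →ₗ[ℂ] K₁) u ⊗ₜ
        TensorProduct.map (S₂ : H₂ →ₗ[ℂ] H₂) (T₂ : K₂ →ₗ[ℂ] K₂) v) := by
  induction u using TensorProduct.induction_on with
  | zero => simp
  | add u₁ u₂ h₁ h₂ => simp only [TensorProduct.add_tmul, map_add, h₁, h₂]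
  | tmul x y =>
  induction v using TensorProduct.induction_on with
  | zero => simp
  | add u₁ u₂ h₁ h₂ => simp only [TensorProduct.tmul_add, map_add, h₁, h₂]
  | tmul z w => simp [tensorShuffle_tmul]

end shuffle

theorem IsQ.comp {Γ₁ : CorrMap X Y A B} {Γ₂ : CorrMap A B Z W} (h₂ : IsQ Γ₂) (h₁ : IsQ Γ₁) :
    IsQ (Γ₂ ∘ₗ Γ₁) := by
  refine ⟨h₂.1.comp h₁.1, ?_⟩
  obtain ⟨-, H₁, _, _, _, K₁, _, _, _, E₁, F₁, ξ, hE₁, hF₁, hξ, rfl⟩ := h₁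
  obtain ⟨-, H₂, _, _, _, K₂, _, _, _, E₂, F₂, η, hE₂, hF₂, hη, rfl⟩ := h₂
  have := FiniteDimensional.complete ℂ H₁
  have := FiniteDimensional.complete ℂ H₂
  have := FiniteDimensional.complete ℂ K₁
  have := FiniteDimensional.complete ℂ K₂
  refine ⟨HilbertTensor H₁ H₂, inferInstance, inferInstance, inferInstance,
    HilbertTensor K₁ K₂, inferInstance, inferInstance, inferInstance,
    compOp (ampLeft H₂) (ampRight H₁) E₁ E₂, compOp (ampLeft K₂) (ampRight K₁) F₁ F₂,
    tensorShuffle H₁ H₂ K₁ K₂ (ξ ⊗ₜ η), hE₁.compOp commute_ampLeft_ampRight hE₂,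
    hF₁.compOp commute_ampLeft_ampRight hF₂, ?_, ?_⟩
  · have h₁ : ⟪ξ, ξ⟫_ℂ = 1 := (inner_self_eq_norm_sq_to_K (𝕜 := ℂ) ξ).trans (by simp [hξ])
    have h₂ : ⟪η, η⟫_ℂ = 1 := (inner_self_eq_norm_sq_to_K (𝕜 := ℂ) η).trans (by simp [hη])
    have h := (inner_self_eq_norm_sq_to_K (𝕜 := ℂ)
      (tensorShuffle H₁ H₂ K₁ K₂ (ξ ⊗ₜ η))).symm.trans (inner_tensorShuffle ξ ξ η η)
    rw [h₁, h₂, one_mul] at h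
    exact (pow_eq_one_iff_of_nonneg (norm_nonneg _) two_ne_zero).1 (Complex.ofReal_eq_one.1
      ((Complex.ofReal_pow _ _).trans h))
  · refine stateMap_comp_stateMap fun i j => ?_
    simp only [odotOp, LinearMap.coe_toContinuousLinearMap', compOp,
      ContinuousLinearMap.toLinearMap_sum, map_sum_sum, LinearMap.sum_apply, map_tensorShuffle,
      inner_sum, inner_tensorShuffle]

end classes

/-! ### Positive elements of C*-subalgebras -/

/-- For self-adjoint `u`, positivity is the norm condition `‖‖u‖ - u‖ ≤ ‖u‖`, which an isometric
homomorphism preserves and reflects. -/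
theorem exists_eq_star_mul_self_of_isometry {𝒜 ℬ : Type} [CStarAlgebra 𝒜] [CStarAlgebra ℬ]
    (f : 𝒜 →⋆ₐ[ℂ] ℬ) (hf : ∀ u, ‖f u‖ = ‖u‖) {u : 𝒜} {w : ℬ} (h : f u = star w * w) :
    ∃ v, u = star v * v := by
  let _ := CStarAlgebra.spectralOrder 𝒜
  have _ := CStarAlgebra.spectralOrderedRing 𝒜
  let _ := CStarAlgebra.spectralOrder ℬ
  have _ := CStarAlgebra.spectralOrderedRing ℬ
  have hinj : Function.Injective f := (injective_iff_map_eq_zero f).2 fun u hu => by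
    rw [← norm_eq_zero, ← hf, hu, norm_zero]
  have hsa : IsSelfAdjoint (f u) := h ▸ IsSelfAdjoint.star_mul_self w
  have hsa' : IsSelfAdjoint u := hinj (by rw [map_star]; exact hsa)
  refine CStarAlgebra.nonneg_iff_eq_star_mul_self.1 (nonneg_iff_isSelfAdjoint_and_quasispectrumRestricts.2
    ⟨hsa', (SpectrumRestricts.nnreal_iff_nnnorm hsa' le_rfl).2 ?_⟩)
  have h0 : 0 ≤ f u := h ▸ star_mul_self_nonneg w
  have hn : ‖f u‖₊ = ‖u‖₊ := NNReal.eq (hf u)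
  have := (SpectrumRestricts.nnreal_iff_nnnorm hsa le_rfl).1
    (nonneg_iff_isSelfAdjoint_and_quasispectrumRestricts.1 h0).2
  rw [hn] at this
  refine le_trans (le_of_eq (NNReal.eq ?_)) this
  change ‖_‖ = ‖_‖
  rw [← hf, map_sub]
  congr 2
  simp [Algebra.algebraMap_eq_smul_one, ← Complex.coe_smul]

section universal

variable {X A : Type} [Fintype A] [DecidableEq X]

/-! ### Coordinates of the universal algebra -/

/-- The coordinate projections of the block diagonal algebra. -/
def blockEval (i : RepClass X A) : BlockAlg X A →⋆ₐ[ℂ] (i.rep.H →L[ℂ] i.rep.H) where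
  toFun u := u i
  map_one' := rfl
  map_mul' _ _ := rfl
  map_zero' := rfl
  map_add' _ _ := rfl
  commutes' _ := rfl
  map_star' _ := rfl

theorem blockEval_blockGen (i : RepClass X A) (g : X × X × A × A) :
    blockEval i (blockGen g) = i.rep.entry g := rfl

theorem norm_blockEval_le (i : RepClass X A) (u : BlockAlg X A) : ‖blockEval i u‖ ≤ ‖u‖ :=
  lp.norm_apply_le_norm ENNReal.top_ne_zero u i

theorem blockAlg_ext {u v : BlockAlg X A} (h : ∀ i, blockEval i u = blockEval i v) : u = v :=
  lp.ext (funext h)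

/-- Factors `w_i` chosen in each block satisfy `‖w_i‖² ≤ ‖u‖`, so they are uniformly bounded and
form an element of the direct sum. Positivity then descends to the subalgebra. -/
theorem exists_eq_star_mul_self_of_blockEval {u : BrownCuntz X A}
    (h : ∀ i x, 0 ≤ ⟪x, blockEval i (u : BlockAlg X A) x⟫_ℂ) : ∃ v, u = star v * v := by
  choose w hw using fun i => exists_eq_star_mul_self_of_nonneg (h i)
  have hb : ∀ i, ‖w i‖ ≤ ‖u‖ + 1 := fun i => by
    have h1 : ‖w i‖ * ‖w i‖ ≤ ‖u‖ := by
      rw [← ContinuousLinearMap.norm_adjoint_comp_self, ← hw]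
      exact norm_blockEval_le i u
    nlinarith [norm_nonneg (w i), norm_nonneg u]
  let W : BlockAlg X A := ⟨w, memℓp_infty ⟨‖u‖ + 1, by rintro _ ⟨i, rfl⟩; exact hb i⟩⟩
  exact exists_eq_star_mul_self_of_isometry (brownCuntz X A).subtype (fun _ => rfl) (w := W)
    (blockAlg_ext hw)

theorem star_gen (x x' : X) (a a' : A) : star (gen x x' a a') = gen x' x a' a := by
  refine Subtype.ext (blockAlg_ext fun i => ?_)
  change (i.rep.entry _).adjoint = i.rep.entry _
  simp [Rep.entry, ContinuousLinearMap.adjoint_comp]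

theorem sum_gen (x x' : X) : ∑ a, gen (A := A) x x' a a = if x = x' then 1 else 0 := by
  refine Subtype.ext (blockAlg_ext fun i => ?_)
  have h1 : ((∑ a, gen (A := A) x x' a a : BrownCuntz X A) : BlockAlg X A) =
      ∑ a, blockGen (x, x', a, a) := map_sum (brownCuntz X A).subtype _ _
  rw [h1, map_sum]
  simp only [blockEval_blockGen, Rep.entry, i.rep.rel]
  split_ifs <;> rfl

/-! ### The universal property -/

variable (X A) in
/-- The evaluation of noncommutative polynomials at the generators of `𝒞_{X,A}`. -/
def polyHom : FreeAlgebra ℂ (X × X × A × A) →ₐ[ℂ] BrownCuntz X A :=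
  FreeAlgebra.lift ℂ fun g => gen g.1 g.2.1 g.2.2.1 g.2.2.2

theorem coe_polyHom (p : FreeAlgebra ℂ (X × X × A × A)) :
    (polyHom X A p : BlockAlg X A) = FreeAlgebra.lift ℂ blockGen p := by
  have : (brownCuntz X A).subtype.toAlgHom.comp (polyHom X A) = FreeAlgebra.lift ℂ blockGen := by
    ext g
    simp [polyHom]
    rfl
  exact congrArg (fun f => f p) this

theorem blockEval_polyHom (i : RepClass X A) (p : FreeAlgebra ℂ (X × X × A × A)) :
    blockEval i (polyHom X A p : BlockAlg X A) = FreeAlgebra.lift ℂ i.rep.entry p := by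
  rw [coe_polyHom]
  have : (blockEval i).toAlgHom.comp (FreeAlgebra.lift ℂ blockGen) =
      FreeAlgebra.lift ℂ i.rep.entry := by
    ext g
    simp [blockEval_blockGen]
  exact congrArg (fun f => f p) this

/-- The set of generators is closed under adjoints, so polynomials without adjoints already form the
generated *-algebra. -/
theorem denseRange_polyHom : DenseRange (polyHom X A) := by
  have hstar : star (Set.range (blockGen (X := X) (A := A))) ⊆ Set.range blockGen := by
    rintro u ⟨g, hg⟩
    refine ⟨(g.2.1, g.1, g.2.2.2, g.2.2.1), ?_⟩
    rw [← star_star u, ← hg]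
    exact congrArg Subtype.val (star_gen g.1 g.2.1 g.2.2.1 g.2.2.2).symm
  intro u
  rw [Topology.IsInducing.subtypeVal.closure_eq_preimage_closure_image]
  have hu : (u : BlockAlg X A) ∈ closure (StarAlgebra.adjoin ℂ
      (Set.range (blockGen (X := X) (A := A))) : Set (BlockAlg X A)) := u.2
  refine closure_mono ?_ hu
  intro v hv
  have hv' : v ∈ Algebra.adjoin ℂ (Set.range (blockGen (X := X) (A := A))) := by
    have : v ∈ (StarAlgebra.adjoin ℂ (Set.range (blockGen (X := X) (A := A)))).toSubalgebra := hv
    rwa [StarAlgebra.adjoin_toSubalgebra, Set.union_eq_self_of_subset_right hstar] at this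
  rw [Algebra.adjoin_range_eq_range_freeAlgebra_lift] at hv'
  obtain ⟨p, rfl⟩ := hv'
  exact ⟨_, ⟨p, rfl⟩, coe_polyHom p⟩

/-- `R` need not be one of the chosen blocks, but the representative of its class induces the same
seminorm. This is what makes the algebra universal. -/
theorem Rep.norm_lift_entry_le (R : Rep X A) (p : FreeAlgebra ℂ (X × X × A × A)) :
    ‖FreeAlgebra.lift ℂ R.entry p‖ ≤ ‖polyHom X A p‖ := by
  let i : RepClass X A := ⟨R.seminorm, R, rfl⟩
  have hi : i.rep.seminorm = R.seminorm := i.2.choose_spec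
  calc ‖FreeAlgebra.lift ℂ R.entry p‖ = ‖FreeAlgebra.lift ℂ i.rep.entry p‖ :=
        (congrFun hi p).symm
    _ ≤ _ := by
      rw [← blockEval_polyHom]
      exact norm_blockEval_le i _

/-- The bounded linear map on `𝒞_{X,A}` induced by a representation of its defining relations. -/
def Rep.homL (R : Rep X A) : BrownCuntz X A →L[ℂ] (R.H →L[ℂ] R.H) :=
  (FreeAlgebra.lift ℂ R.entry).toLinearMap.extendOfNorm (polyHom X A).toLinearMap

theorem Rep.homL_polyHom (R : Rep X A) (p : FreeAlgebra ℂ (X × X × A × A)) :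
    R.homL (polyHom X A p) = FreeAlgebra.lift ℂ R.entry p :=
  LinearMap.extendOfNorm_eq (f := (FreeAlgebra.lift ℂ R.entry).toLinearMap)
    (e := (polyHom X A).toLinearMap) denseRange_polyHom
    ⟨1, fun q => (R.norm_lift_entry_le q).trans_eq (one_mul _).symm⟩ p

theorem polyHom_ι (g : X × X × A × A) :
    polyHom X A (FreeAlgebra.ι ℂ g) = gen g.1 g.2.1 g.2.2.1 g.2.2.2 :=
  FreeAlgebra.lift_ι_apply _ _

theorem Rep.homL_gen (R : Rep X A) (x x' : X) (a a' : A) :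
    R.homL (gen x x' a a') = R.entry (x, x', a, a') :=
  (congrArg R.homL (polyHom_ι (x, x', a, a')).symm).trans
    ((R.homL_polyHom _).trans (FreeAlgebra.lift_ι_apply _ _))

theorem Rep.homL_one (R : Rep X A) : R.homL 1 = 1 := by
  rw [← map_one (polyHom X A), R.homL_polyHom, map_one]

theorem Rep.homL_mul (R : Rep X A) (u v : BrownCuntz X A) :
    R.homL (u * v) = R.homL u * R.homL v := by
  induction u, v using (denseRange_polyHom (X := X) (A := A)).induction_on₂ with
  | hp => exact isClosed_eq (by fun_prop) (by fun_prop)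
  | h p q => rw [← map_mul, R.homL_polyHom, R.homL_polyHom, R.homL_polyHom, map_mul]

theorem Rep.homL_star (R : Rep X A) (u : BrownCuntz X A) : R.homL (star u) = star (R.homL u) := by
  induction u using (denseRange_polyHom (X := X) (A := A)).induction_on with
  | hp => exact isClosed_eq (by fun_prop) (by fun_prop)
  | ih p =>
    refine FreeAlgebra.induction ℂ _
      (motive := fun p => R.homL (star (polyHom X A p)) = star (R.homL (polyHom X A p)))
      (fun c => ?_) (fun g => ?_) (fun p q hp hq => ?_) (fun p q hp hq => ?_) p
    · rw [AlgHom.commutes, Algebra.algebraMap_eq_smul_one, star_smul, star_one, map_smul,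
        R.homL_one, map_smul, R.homL_one, star_smul, star_one]
    · rw [polyHom_ι, star_gen, R.homL_gen, R.homL_gen, ContinuousLinearMap.star_eq_adjoint]
      simp [Rep.entry, ContinuousLinearMap.adjoint_comp]
    · rw [map_mul, star_mul, R.homL_mul, R.homL_mul, hp, hq, star_mul]
    · rw [map_add, star_add, map_add, hp, hq, map_add, star_add]

/-- The representation of `𝒞_{X,A}` induced by a representation of its defining relations. -/
def Rep.hom (R : Rep X A) : BrownCuntz X A →⋆ₐ[ℂ] (R.H →L[ℂ] R.H) where
  toFun := R.homL
  map_one' := R.homL_one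
  map_mul' := R.homL_mul
  map_zero' := map_zero R.homL
  map_add' := map_add R.homL
  commutes' c := by
    rw [Algebra.algebraMap_eq_smul_one, map_smul, R.homL_one, Algebra.algebraMap_eq_smul_one]
  map_star' := R.homL_star

/-- A stochastic operator matrix on a nonzero Hilbert space induces a representation of
`𝒞_{X,A}`. -/
theorem IsStochOp.exists_hom [Fintype X] {H : Type} [NormedAddCommGroup H] [InnerProductSpace ℂ H]
    [CompleteSpace H] [Nontrivial H] {E : Matrix (X × A) (X × A) (H →L[ℂ] H)} (hE : IsStochOp E) :
    ∃ π : BrownCuntz X A →⋆ₐ[ℂ] (H →L[ℂ] H),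
      ∀ x x' a a', π (gen x x' a a') = E (x, a) (x', a') := by
  obtain ⟨V, hV⟩ := exists_adjoint_comp_eq hE.pos
  let R : Rep X A :=
    { H := H
      K := PiLp 2 (fun _ : X × A => H)
      V := fun a x => V (x, a)
      rel := fun x x' => by
        simp only [← hV]
        exact hE.trace x x' }
  exact ⟨R.hom, fun x x' a a' => (R.homL_gen x x' a a').trans (hV _ _).symm⟩

end universal

/-! ### Cyclic representations and vector functionals -/

/-- A representation with a cyclic unit vector that implements the functional `τ`. -/
structure CyclicRep {𝒜 : Type} [CStarAlgebra 𝒜] (τ : 𝒜 →ₗ[ℂ] ℂ) : Type 1 where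
  H : Type
  [nH : NormedAddCommGroup H]
  [iH : InnerProductSpace ℂ H]
  [cH : CompleteSpace H]
  hom : 𝒜 →⋆ₐ[ℂ] (H →L[ℂ] H)
  vec : H
  dense : DenseRange fun u => hom u vec
  norm_vec : ‖vec‖ = 1
  apply_eq : ∀ u, τ u = ⟪vec, hom u vec⟫_ℂ

attribute [instance] CyclicRep.nH CyclicRep.iH CyclicRep.cH

/-- The GNS construction, with the class of `1` as cyclic vector. -/
theorem IsState.nonempty_cyclicRep {𝒜 : Type} [CStarAlgebra 𝒜] {τ : 𝒜 →ₗ[ℂ] ℂ} (h : IsState τ) :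
    Nonempty (CyclicRep τ) := by
  let _ := CStarAlgebra.spectralOrder 𝒜
  have _ := CStarAlgebra.spectralOrderedRing 𝒜
  let f : 𝒜 →ₚ[ℂ] ℂ := PositiveLinearMap.mk₀ τ fun u hu => by
    obtain ⟨v, rfl⟩ := CStarAlgebra.nonneg_iff_eq_star_mul_self.1 hu
    exact h.2 v
  have hf : ∀ u, f u = τ u := fun _ => rfl
  let ξ : f.GNS := ((f.toPreGNS 1 : f.PreGNS) : UniformSpace.Completion f.PreGNS)
  have hξ : ∀ u, f.gnsStarAlgHom u ξ = ((f.toPreGNS u : f.PreGNS) : f.GNS) := fun u => by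
    simp [ξ]
  have hin : ∀ u, τ u = ⟪ξ, f.gnsStarAlgHom u ξ⟫_ℂ := fun u => by
    rw [hξ, UniformSpace.Completion.inner_coe, PositiveLinearMap.preGNS_inner_def]
    simp [hf]
  refine ⟨{ H := f.GNS, hom := f.gnsStarAlgHom, vec := ξ, dense := ?_, norm_vec := ?_,
            apply_eq := hin }⟩
  · simp only [hξ]
    exact UniformSpace.Completion.denseRange_coe.comp f.toPreGNS.surjective.denseRange
      (UniformSpace.Completion.continuous_coe _)
  · have h1 := hin 1
    rw [h.1, map_one, one_apply_eq_self, inner_self_eq_norm_sq_to_K] at h1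
    exact (pow_eq_one_iff_of_nonneg (norm_nonneg _) two_ne_zero).1 (Complex.ofReal_eq_one.1
      ((Complex.ofReal_pow _ _).trans h1.symm))

/-- The functional `u ↦ ⟨π(u) ξ, ξ⟩`. -/
def vectorFunctional {𝒜 H : Type} [CStarAlgebra 𝒜] [NormedAddCommGroup H] [InnerProductSpace ℂ H]
    [CompleteSpace H] (π : 𝒜 →⋆ₐ[ℂ] (H →L[ℂ] H)) (ξ : H) : 𝒜 →ₗ[ℂ] ℂ where
  toFun u := ⟪ξ, π u ξ⟫_ℂ
  map_add' u v := by simp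
  map_smul' c u := by simp

section vectorFunctional

variable {𝒜 H : Type} [CStarAlgebra 𝒜] [NormedAddCommGroup H] [InnerProductSpace ℂ H]
  [CompleteSpace H]

theorem inner_star_mul_self (π : 𝒜 →⋆ₐ[ℂ] (H →L[ℂ] H)) (ξ : H) (u v : 𝒜) :
    ⟪ξ, π (star u * v) ξ⟫_ℂ = ⟪π u ξ, π v ξ⟫_ℂ := by
  rw [map_mul, map_star, ContinuousLinearMap.star_eq_adjoint, mul_apply_eq_comp,
    ContinuousLinearMap.adjoint_inner_right]

theorem isState_vectorFunctional (π : 𝒜 →⋆ₐ[ℂ] (H →L[ℂ] H)) {ξ : H} (hξ : ‖ξ‖ = 1) :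
    IsState (vectorFunctional π ξ) := by
  refine ⟨?_, fun u => ?_⟩
  · simp [vectorFunctional, inner_self_eq_norm_sq_to_K, hξ]
  · change 0 ≤ ⟪ξ, π (star u * u) ξ⟫_ℂ
    rw [inner_star_mul_self, inner_self_eq_norm_sq_to_K]
    positivity

theorem continuous_hom {ℬ : Type} [CStarAlgebra ℬ] (π : 𝒜 →⋆ₐ[ℂ] ℬ) : Continuous π :=
  AddMonoidHomClass.continuous_of_bound π 1 fun u =>
    (NonUnitalStarAlgHom.norm_apply_le π u).trans_eq (one_mul _).symm

theorem continuous_vectorFunctional (π : 𝒜 →⋆ₐ[ℂ] (H →L[ℂ] H)) (ξ : H) :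
    Continuous (vectorFunctional π ξ) := by
  have h := continuous_hom π
  change Continuous fun u => ⟪ξ, π u ξ⟫_ℂ
  fun_prop

end vectorFunctional

namespace CyclicRep

variable {𝒜 : Type} [CStarAlgebra 𝒜] {τ : 𝒜 →ₗ[ℂ] ℂ} (C : CyclicRep τ)

/-- The hypothesis gives the squared norms of the images under `C.hom u` of the dense set of vectors
`C.hom v C.vec`. -/
theorem hom_eq_zero {u : 𝒜} (h : ∀ v, τ (star (u * v) * (u * v)) = 0) : C.hom u = 0 := by
  refine ContinuousLinearMap.coeFn_injective
    (C.dense.equalizer (C.hom u).continuous continuous_const (funext fun v => ?_))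
  have h1 := h v
  rw [C.apply_eq, inner_star_mul_self, inner_self_eq_zero, map_mul] at h1
  exact h1

/-- The GNS representation of `τ ∘ π` kills the kernel of `π`; in this way it inherits finite
dimensionality and commutativity from `ℬ`. -/
theorem hom_eq_zero_of_comp {ℬ : Type} [CStarAlgebra ℬ] {τ : ℬ →ₗ[ℂ] ℂ} {π : 𝒜 →⋆ₐ[ℂ] ℬ}
    (C : CyclicRep (τ ∘ₗ π.toAlgHom.toLinearMap)) {u : 𝒜} (h : π u = 0) : C.hom u = 0 := by
  refine C.hom_eq_zero fun v => ?_
  change τ (π (star (u * v) * (u * v))) = 0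
  rw [map_mul π, map_mul π, h, zero_mul, mul_zero, map_zero]

theorem finiteDimensional {ℬ : Type} [CStarAlgebra ℬ] [FiniteDimensional ℂ ℬ] {τ : ℬ →ₗ[ℂ] ℂ}
    {π : 𝒜 →⋆ₐ[ℂ] ℬ} (C : CyclicRep (τ ∘ₗ π.toAlgHom.toLinearMap)) : FiniteDimensional ℂ C.H := by
  let f : 𝒜 →ₗ[ℂ] C.H :=
    { toFun := fun u => C.hom u C.vec
      map_add' := fun u v => by simp
      map_smul' := fun c u => by simp }
  let p : 𝒜 →ₗ[ℂ] ℬ := π.toAlgHom.toLinearMap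
  have hker : LinearMap.ker p ≤ LinearMap.ker f := fun u hu => by
    have : C.hom u = 0 := C.hom_eq_zero_of_comp hu
    simp [f, this]
  have : FiniteDimensional ℂ (𝒜 ⧸ LinearMap.ker p) :=
    Module.Finite.equiv p.quotKerEquivRange.symm
  refine finiteDimensional_of_denseRange ((LinearMap.ker p).liftQ f hker) ?_
  refine C.dense.mono ?_
  rintro _ ⟨u, rfl⟩
  exact ⟨Submodule.Quotient.mk u, rfl⟩

theorem commute_hom {ℬ : Type} [CStarAlgebra ℬ] (hℬ : ∀ u v : ℬ, u * v = v * u) {τ : ℬ →ₗ[ℂ] ℂ}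
    {π : 𝒜 →⋆ₐ[ℂ] ℬ} (C : CyclicRep (τ ∘ₗ π.toAlgHom.toLinearMap)) (u v : 𝒜) :
    Commute (C.hom u) (C.hom v) := by
  have : C.hom (u * v - v * u) = 0 :=
    C.hom_eq_zero_of_comp (by rw [map_sub, map_mul, map_mul, hℬ, sub_self])
  rwa [map_sub, map_mul, map_mul, sub_eq_zero] at this

end CyclicRep

/-! ### Tensor products of cyclic representations -/

theorem map_mul_comm_of_tmul {𝒜 ℬ : Type} [Ring 𝒜] [Algebra ℂ 𝒜] [Ring ℬ] [Algebra ℂ ℬ]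
    (ω : 𝒜 ⊗[ℂ] ℬ →ₗ[ℂ] ℂ)
    (h : ∀ u u' v v', ω ((u * u') ⊗ₜ (v * v')) = ω ((u' * u) ⊗ₜ (v' * v))) (s t : 𝒜 ⊗[ℂ] ℬ) :
    ω (s * t) = ω (t * s) := by
  induction s using TensorProduct.induction_on with
  | zero => rw [zero_mul, mul_zero]
  | add s₁ s₂ hs₁ hs₂ => rw [add_mul, mul_add, map_add, map_add, hs₁, hs₂]
  | tmul u v =>
    induction t using TensorProduct.induction_on with
    | zero => rw [zero_mul, mul_zero]
    | add s₁ s₂ hs₁ hs₂ => rw [add_mul, mul_add, map_add, map_add, hs₁, hs₂]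
    | tmul u' v' =>
      rw [Algebra.TensorProduct.tmul_mul_tmul, Algebra.TensorProduct.tmul_mul_tmul, h]

section product

variable {𝒜 ℬ : Type} [CStarAlgebra 𝒜] [CStarAlgebra ℬ] {τ₁ : 𝒜 →ₗ[ℂ] ℂ} {τ₂ : ℬ →ₗ[ℂ] ℂ}
  (C₁ : CyclicRep τ₁) (C₂ : CyclicRep τ₂)

/-- The vector implementing the product functional. -/
abbrev vecTensor : HilbertTensor C₁.H C₂.H := .tmul C₁.vec C₂.vec

theorem norm_vecTensor : ‖vecTensor C₁ C₂‖ = 1 := by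
  rw [vecTensor, HilbertTensor.norm_tmul, C₁.norm_vec, C₂.norm_vec, one_mul]

/-- The representation `u ⊗ v ↦ π₁(u) ⊗ π₂(v)` of the algebraic tensor product. -/
def prodHom : 𝒜 ⊗[ℂ] ℬ →ₐ[ℂ] (HilbertTensor C₁.H C₂.H →L[ℂ] HilbertTensor C₁.H C₂.H) :=
  Algebra.TensorProduct.lift ((ampLeft C₂.H).comp C₁.hom).toAlgHom
    ((ampRight C₁.H).comp C₂.hom).toAlgHom fun _ _ => commute_ampLeft_ampRight _ _

theorem prodHom_tmul (u : 𝒜) (v : ℬ) :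
    prodHom C₁ C₂ (u ⊗ₜ v) = ampLeft C₂.H (C₁.hom u) * ampRight C₁.H (C₂.hom v) :=
  Algebra.TensorProduct.lift_tmul _ _ _ _ _

/-- The product functional `τ₁ ⊗ τ₂` on the algebraic tensor product. -/
def prodFunctional : 𝒜 ⊗[ℂ] ℬ →ₗ[ℂ] ℂ where
  toFun t := ⟪vecTensor C₁ C₂, prodHom C₁ C₂ t (vecTensor C₁ C₂)⟫_ℂ
  map_add' s t := by simp
  map_smul' c t := by simp

theorem prodFunctional_tmul (u : 𝒜) (v : ℬ) : prodFunctional C₁ C₂ (u ⊗ₜ v) = τ₁ u * τ₂ v := by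
  change ⟪vecTensor C₁ C₂, prodHom C₁ C₂ (u ⊗ₜ v) (vecTensor C₁ C₂)⟫_ℂ = _
  rw [prodHom_tmul, mul_apply_eq_comp, ampRight_tmul, ampLeft_tmul, HilbertTensor.inner_tmul,
    C₁.apply_eq, C₂.apply_eq]

theorem prodFunctional_map_mul_comm (h₁ : IsTrace τ₁) (h₂ : IsTrace τ₂) {R : Type} [Semiring R]
    [Algebra ℂ R] (f : R →ₐ[ℂ] 𝒜 ⊗[ℂ] ℬ) (p q : R) :
    prodFunctional C₁ C₂ (f (p * q)) = prodFunctional C₁ C₂ (f (q * p)) := by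
  rw [map_mul f, map_mul f]
  refine map_mul_comm_of_tmul _ (fun u u' v v' => ?_) _ _
  rw [prodFunctional_tmul, prodFunctional_tmul, h₁.2, h₂.2]

end product

/-! ### The stochastic operator matrix of a cyclic representation -/

section operator

variable {X A : Type} [Fintype X] [Fintype A] [DecidableEq X] {τ : BrownCuntz X A →ₗ[ℂ] ℂ}

/-- The images of the generators of `𝒞_{X,A}`. -/
def CyclicRep.op (C : CyclicRep τ) : Matrix (X × A) (X × A) (C.H →L[ℂ] C.H) :=
  fun i j => C.hom (gen i.1 j.1 i.2 j.2)

/-- Positivity of the matrix of generators, phrased inside `𝒞_{X,A}`, to which the operators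
`v_{a,x}` do not belong. In each block the quadratic form is the squared norm of `∑_i V_i c_i x`. -/
theorem exists_sum_gen_eq_star_mul_self (c : X × A → BrownCuntz X A) :
    ∃ v, ∑ i, ∑ j, star (c i) * (gen i.1 j.1 i.2 j.2 * c j) = star v * v := by
  refine exists_eq_star_mul_self_of_blockEval fun k x => ?_
  let f : BrownCuntz X A →⋆ₐ[ℂ] (k.rep.H →L[ℂ] k.rep.H) :=
    (blockEval k).comp (brownCuntz X A).subtype
  have hf : ∀ i j : X × A, f (gen i.1 j.1 i.2 j.2) =
      (k.rep.V i.2 i.1).adjoint ∘L k.rep.V j.2 j.1 := fun _ _ => rfl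
  change 0 ≤ ⟪x, f _ x⟫_ℂ
  have h : ⟪x, f (∑ i, ∑ j, star (c i) * (gen i.1 j.1 i.2 j.2 * c j)) x⟫_ℂ =
      ⟪∑ i : X × A, k.rep.V i.2 i.1 (f (c i) x), ∑ i : X × A, k.rep.V i.2 i.1 (f (c i) x)⟫_ℂ := by
    simp only [map_sum, _root_.sum_apply, inner_sum, sum_inner, inner_star_mul_self]
    rw [Finset.sum_comm]
    refine Finset.sum_congr rfl fun i _ => Finset.sum_congr rfl fun j _ => ?_
    rw [map_mul, hf, mul_apply_eq_comp, ContinuousLinearMap.comp_apply,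
      ContinuousLinearMap.adjoint_inner_right]
  rw [h, inner_self_eq_norm_sq_to_K]
  positivity

/-- On tuples of vectors `C.hom (c i) C.vec` the form is the value of `τ` at a positive element;
such tuples are dense. -/
theorem CyclicRep.isStochOp_op (C : CyclicRep τ) : IsStochOp C.op where
  pos η := by
    have hd : DenseRange (Pi.map fun (_ : X × A) (u : BrownCuntz X A) => C.hom u C.vec) :=
      DenseRange.piMap fun _ => C.dense
    induction η using hd.induction_on with
    | hp => exact isClosed_le continuous_const (by fun_prop)
    | ih c =>
      obtain ⟨v, hv⟩ := exists_sum_gen_eq_star_mul_self c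
      have h : ∑ i, ∑ j, ⟪C.hom (c i) C.vec, C.op i j (C.hom (c j) C.vec)⟫_ℂ =
          ⟪C.hom v C.vec, C.hom v C.vec⟫_ℂ := by
        rw [← inner_star_mul_self, ← hv]
        simp only [map_sum, _root_.sum_apply, inner_sum, inner_star_mul_self, CyclicRep.op]
        refine Finset.sum_congr rfl fun i _ => Finset.sum_congr rfl fun j _ => ?_
        rw [map_mul, mul_apply_eq_comp]
      change 0 ≤ ∑ i, ∑ j, ⟪C.hom (c i) C.vec, C.op i j (C.hom (c j) C.vec)⟫_ℂ
      rw [h, inner_self_eq_norm_sq_to_K]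
      positivity
  trace x x' := by
    simp only [CyclicRep.op]
    rw [← map_sum, sum_gen]
    split_ifs <;> simp

end operator

/-! ### Composition of tracial correlations -/

section comp

variable {X A Z : Type} [Fintype X] [Fintype A] [Fintype Z] [DecidableEq X] [DecidableEq A]
  {τ₁ : BrownCuntz X A →ₗ[ℂ] ℂ} {τ₂ : BrownCuntz A Z →ₗ[ℂ] ℂ} (C₁ : CyclicRep τ₁)
  (C₂ : CyclicRep τ₂)

/-- The composition of the stochastic operator matrices of two cyclic representations. -/
abbrev compCyclic :
    Matrix (X × Z) (X × Z) (HilbertTensor C₁.H C₂.H →L[ℂ] HilbertTensor C₁.H C₂.H) :=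
  compOp (ampLeft C₂.H) (ampRight C₁.H) C₁.op C₂.op

theorem exists_hom_compCyclic :
    ∃ π : BrownCuntz X Z →⋆ₐ[ℂ] (HilbertTensor C₁.H C₂.H →L[ℂ] HilbertTensor C₁.H C₂.H),
      ∀ x x' z z', π (gen x x' z z') = compCyclic C₁ C₂ (x, z) (x', z') := by
  have : Nontrivial (HilbertTensor C₁.H C₂.H) :=
    ⟨vecTensor C₁ C₂, 0, fun h => by simpa [h] using norm_vecTensor C₁ C₂⟩
  exact (C₁.isStochOp_op.compOp commute_ampLeft_ampRight C₂.isStochOp_op).exists_hom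

variable {C₁ C₂}
  {π : BrownCuntz X Z →⋆ₐ[ℂ] (HilbertTensor C₁.H C₂.H →L[ℂ] HilbertTensor C₁.H C₂.H)}

theorem traceMap_comp_traceMap
    (hπ : ∀ x x' z z', π (gen x x' z z') = compCyclic C₁ C₂ (x, z) (x', z')) :
    traceMap τ₂ ∘ₗ traceMap τ₁ = traceMap (vectorFunctional π (vecTensor C₁ C₂)) := by
  refine (ofChoi_comp _ _).trans (congrArg ofChoi (Matrix.ext fun i j => ?_))
  change _ = ⟪vecTensor C₁ C₂, π _ (vecTensor C₁ C₂)⟫_ℂ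
  rw [map_mul, hπ, hπ, compOp_mul_compOp_apply_tmul]
  simp only [inner_sum, HilbertTensor.inner_tmul, Matrix.of_apply, C₁.apply_eq, C₂.apply_eq,
    map_mul, CyclicRep.op, Fintype.sum_prod_type]
  -- The second generator carries its indices in reverse order, so the second components of the two
  -- summation pairs are interchanged between the sides.
  refine Finset.sum_congr rfl fun a _ => ?_
  rw [Finset.sum_comm]
  conv_rhs => rw [Finset.sum_comm]
  refine Finset.sum_congr rfl fun a' _ => ?_
  rw [Finset.sum_comm]

variable (X A Z) in
/-- The homomorphism `e_{x,x',z,z'} ↦ ∑_{a,a'} e_{x,x',a,a'} ⊗ e_{a,a',z,z'}`. -/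
def comulHom : FreeAlgebra ℂ (X × X × Z × Z) →ₐ[ℂ] BrownCuntz X A ⊗[ℂ] BrownCuntz A Z :=
  FreeAlgebra.lift ℂ fun k => ∑ a, ∑ a', gen k.1 k.2.1 a a' ⊗ₜ gen a a' k.2.2.1 k.2.2.2

omit [Fintype X] in
-- Two homomorphisms on a free algebra that agree on its generators. On polynomials `π` thus factors
-- through the algebraic tensor product, where the product of the traces is visible.
theorem hom_polyHom (hπ : ∀ x x' z z', π (gen x x' z z') = compCyclic C₁ C₂ (x, z) (x', z'))
    (p : FreeAlgebra ℂ (X × X × Z × Z)) :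
    π (polyHom X Z p) = prodHom C₁ C₂ (comulHom X A Z p) := by
  have hg : π.toAlgHom.comp (polyHom X Z) = (prodHom C₁ C₂).comp (comulHom X A Z) := by
    ext1
    funext k
    change π (polyHom X Z (FreeAlgebra.ι ℂ k)) = prodHom C₁ C₂ (comulHom X A Z (FreeAlgebra.ι ℂ k))
    rw [polyHom_ι, comulHom, FreeAlgebra.lift_ι_apply]
    simp only [map_sum, prodHom_tmul]
    exact hπ _ _ _ _
  exact congrArg (fun f => f p) hg

omit [Fintype X] in
-- On polynomials the functional is `τ₁ ⊗ τ₂` composed with `comulHom`, so it is tracial there;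
-- continuity and density extend this.
theorem isTrace_vectorFunctional (h₁ : IsTrace τ₁) (h₂ : IsTrace τ₂)
    (hπ : ∀ x x' z z', π (gen x x' z z') = compCyclic C₁ C₂ (x, z) (x', z')) :
    IsTrace (vectorFunctional π (vecTensor C₁ C₂)) := by
  refine ⟨isState_vectorFunctional π (norm_vecTensor C₁ C₂), fun u v => ?_⟩
  have hp : ∀ p, vectorFunctional π (vecTensor C₁ C₂) (polyHom X Z p) =
      prodFunctional C₁ C₂ (comulHom X A Z p) := fun p =>
    congrArg (fun T : _ →L[ℂ] _ => ⟪vecTensor C₁ C₂, T (vecTensor C₁ C₂)⟫_ℂ) (hom_polyHom hπ p)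
  induction u, v using (denseRange_polyHom (X := X) (A := Z)).induction_on₂ with
  | hp =>
    have := continuous_vectorFunctional π (vecTensor C₁ C₂)
    exact isClosed_eq (by fun_prop) (by fun_prop)
  | h p q =>
    rw [← map_mul, ← map_mul, hp, hp, prodFunctional_map_mul_comm C₁ C₂ h₁ h₂]

end comp

/-! ### The closure of the image of a representation -/

section image

variable {𝒜 H : Type} [CStarAlgebra 𝒜] [NormedAddCommGroup H] [InnerProductSpace ℂ H]
  [CompleteSpace H] (π : 𝒜 →⋆ₐ[ℂ] (H →L[ℂ] H))

/-- The C*-algebra generated by the image of a representation. -/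
def imageAlg : StarSubalgebra ℂ (H →L[ℂ] H) := π.range.topologicalClosure

instance : CStarAlgebra (imageAlg π) :=
  StarSubalgebra.cstarAlgebra (imageAlg π)
    (h_closed := StarSubalgebra.isClosed_topologicalClosure _)

/-- The representation as a homomorphism to the C*-algebra generated by its image. -/
def toImageAlg : 𝒜 →⋆ₐ[ℂ] imageAlg π :=
  π.codRestrict _ fun u => StarSubalgebra.le_topologicalClosure _ ⟨u, rfl⟩

theorem denseRange_toImageAlg : DenseRange (toImageAlg π) := by
  intro u
  rw [Topology.IsInducing.subtypeVal.closure_eq_preimage_closure_image]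
  have hu : (u : H →L[ℂ] H) ∈ closure (π.range : Set (H →L[ℂ] H)) := u.2
  refine closure_mono ?_ hu
  rintro _ ⟨v, rfl⟩
  exact ⟨_, ⟨v, rfl⟩, rfl⟩

theorem isTrace_vectorFunctional_subtype {ξ : H} (h : IsTrace (vectorFunctional π ξ)) :
    IsTrace (vectorFunctional (imageAlg π).subtype ξ) := by
  have hc := continuous_vectorFunctional (imageAlg π).subtype ξ
  have hval : ∀ u, vectorFunctional (imageAlg π).subtype ξ (toImageAlg π u) =
    vectorFunctional π ξ u := fun _ => rfl
  refine ⟨⟨?_, ?_⟩, fun u v => ?_⟩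
  · rw [← map_one (toImageAlg π), hval, h.1.1]
  · intro u
    change 0 ≤ ⟪ξ, (imageAlg π).subtype (star u * u) ξ⟫_ℂ
    rw [inner_star_mul_self, inner_self_eq_norm_sq_to_K]
    positivity
  · induction u, v using (denseRange_toImageAlg π).induction_on₂ with
    | hp => exact isClosed_eq (by fun_prop) (by fun_prop)
    | h u v => rw [← map_mul, ← map_mul, hval, hval, h.2]

theorem imageAlg_mul_comm (h : ∀ u v, Commute (π u) (π v)) (u v : imageAlg π) :
    u * v = v * u := by
  induction u, v using (denseRange_toImageAlg π).induction_on₂ with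
  | hp => exact isClosed_eq (by fun_prop) (by fun_prop)
  | h u v => exact Subtype.ext (h u v)

instance [FiniteDimensional ℂ H] : FiniteDimensional ℂ (imageAlg π) :=
  have : FiniteDimensional ℂ (H →L[ℂ] H) := inferInstance
  FiniteDimensional.finiteDimensional_submodule (Subalgebra.toSubmodule (imageAlg π).toSubalgebra)

end image

/-! ### Composition of the three tracial classes -/

section classes

variable {X A Z : Type} [Fintype X] [Fintype A] [Fintype Z] [DecidableEq X] [DecidableEq A]

theorem IsTracial.comp {Γ₁ : CorrMap X X A A} {Γ₂ : CorrMap A A Z Z} (h₂ : IsTracial Γ₂)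
    (h₁ : IsTracial Γ₁) : IsTracial (Γ₂ ∘ₗ Γ₁) := by
  refine ⟨h₂.1.comp h₁.1, ?_⟩
  obtain ⟨-, τ₁, t₁, rfl⟩ := h₁
  obtain ⟨-, τ₂, t₂, rfl⟩ := h₂
  obtain ⟨C₁⟩ := t₁.1.nonempty_cyclicRep
  obtain ⟨C₂⟩ := t₂.1.nonempty_cyclicRep
  obtain ⟨π, hπ⟩ := exists_hom_compCyclic C₁ C₂
  exact ⟨_, isTrace_vectorFunctional t₁ t₂ hπ, traceMap_comp_traceMap hπ⟩

theorem IsState.comp {𝒜 ℬ : Type} [CStarAlgebra 𝒜] [CStarAlgebra ℬ] {τ : ℬ →ₗ[ℂ] ℂ}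
    (h : IsState τ) (π : 𝒜 →⋆ₐ[ℂ] ℬ) : IsState (τ ∘ₗ π.toAlgHom.toLinearMap) := by
  refine ⟨?_, fun u => ?_⟩
  · change τ (π 1) = 1
    rw [map_one, h.1]
  · change 0 ≤ τ (π (star u * u))
    rw [map_mul π, map_star π]
    exact h.2 _

theorem IsTrace.comp {𝒜 ℬ : Type} [CStarAlgebra 𝒜] [CStarAlgebra ℬ] {τ : ℬ →ₗ[ℂ] ℂ}
    (h : IsTrace τ) (π : 𝒜 →⋆ₐ[ℂ] ℬ) : IsTrace (τ ∘ₗ π.toAlgHom.toLinearMap) := by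
  refine ⟨h.1.comp π, fun u v => ?_⟩
  change τ (π (u * v)) = τ (π (v * u))
  rw [map_mul π, map_mul π, h.2]

/-- The GNS spaces of `τᵢ ∘ πᵢ` are finite dimensional, hence so is the algebra of operators on
their tensor product that the composed representation generates. -/
theorem IsQTracial.comp {Γ₁ : CorrMap X X A A} {Γ₂ : CorrMap A A Z Z} (h₂ : IsQTracial Γ₂)
    (h₁ : IsQTracial Γ₁) : IsQTracial (Γ₂ ∘ₗ Γ₁) := by
  refine ⟨h₂.1.comp h₁.1, ?_⟩
  obtain ⟨-, 𝒜₁, _, _, τ₁, π₁, t₁, rfl⟩ := h₁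
  obtain ⟨-, 𝒜₂, _, _, τ₂, π₂, t₂, rfl⟩ := h₂
  obtain ⟨C₁⟩ := (t₁.1.comp π₁).nonempty_cyclicRep
  obtain ⟨C₂⟩ := (t₂.1.comp π₂).nonempty_cyclicRep
  have := C₁.finiteDimensional
  have := C₂.finiteDimensional
  obtain ⟨π, hπ⟩ := exists_hom_compCyclic C₁ C₂
  exact ⟨imageAlg π, inferInstance, inferInstance,
    vectorFunctional (imageAlg π).subtype (vecTensor C₁ C₂), toImageAlg π,
    isTrace_vectorFunctional_subtype π
      (isTrace_vectorFunctional (t₁.comp π₁) (t₂.comp π₂) hπ), traceMap_comp_traceMap hπ⟩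

omit [Fintype X] in
-- The elements whose image commutes with a fixed `T` form a closed subalgebra; this is used once in
-- each variable.
theorem commute_of_commute_gen {ℬ : Type} [CStarAlgebra ℬ] (π : BrownCuntz X Z →⋆ₐ[ℂ] ℬ)
    (h : ∀ x x' z z' y y' w w', Commute (π (gen x x' z z')) (π (gen y y' w w')))
    (u v : BrownCuntz X Z) : Commute (π u) (π v) := by
  have hc := continuous_hom π
  have key : ∀ (T : ℬ), (∀ x x' z z', Commute (π (gen x x' z z')) T) → ∀ u, Commute (π u) T := by
    intro T hT u
    induction u using (denseRange_polyHom (X := X) (A := Z)).induction_on with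
    | hp => exact isClosed_eq (by fun_prop) (by fun_prop)
    | ih p =>
      refine FreeAlgebra.induction ℂ _ (motive := fun p => Commute (π (polyHom X Z p)) T)
        (fun c => ?_) (fun g => ?_) (fun p q hp hq => ?_) (fun p q hp hq => ?_) p
      · rw [AlgHom.commutes, AlgHomClass.commutes]
        exact Algebra.commutes _ _
      · rw [polyHom_ι]
        exact hT _ _ _ _
      · rw [map_mul, map_mul]
        exact hp.mul_left hq
      · rw [map_add, map_add]
        exact hp.add_left hq
  exact key _ (fun x x' z z' => (key _ (fun y y' w w' => h _ _ _ _ _ _ _ _) v).symm) u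

/-- The entries of each GNS operator matrix commute with one another, so those of the composed
matrix do too: `commute_compOp` is applied with the two players' matrices equal. -/
theorem IsLocTracial.comp {Γ₁ : CorrMap X X A A} {Γ₂ : CorrMap A A Z Z} (h₂ : IsLocTracial Γ₂)
    (h₁ : IsLocTracial Γ₁) : IsLocTracial (Γ₂ ∘ₗ Γ₁) := by
  refine ⟨h₂.1.comp h₁.1, ?_⟩
  obtain ⟨-, 𝒜₁, _, c₁, τ₁, π₁, t₁, rfl⟩ := h₁
  obtain ⟨-, 𝒜₂, _, c₂, τ₂, π₂, t₂, rfl⟩ := h₂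
  obtain ⟨C₁⟩ := (t₁.comp π₁).nonempty_cyclicRep
  obtain ⟨C₂⟩ := (t₂.comp π₂).nonempty_cyclicRep
  obtain ⟨π, hπ⟩ := exists_hom_compCyclic C₁ C₂
  refine ⟨imageAlg π, inferInstance, imageAlg_mul_comm π (commute_of_commute_gen π ?_),
    vectorFunctional (imageAlg π).subtype (vecTensor C₁ C₂), toImageAlg π,
    isState_vectorFunctional _ (norm_vecTensor C₁ C₂), traceMap_comp_traceMap hπ⟩
  intro x x' z z' y y' w w'
  rw [hπ, hπ]
  exact commute_compOp commute_ampLeft_ampRight (fun _ _ _ _ => C₁.commute_hom c₁ _ _)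
    (fun _ _ _ _ => C₂.commute_hom c₂ _ _) _ _ _ _

end classes

end QNG

end

theorem theorem9p13 {X Y A B Z W : Type} [Fintype X] [Fintype Y] [Fintype A] [Fintype B]
    [Fintype Z] [Fintype W] [DecidableEq X] [DecidableEq Y] [DecidableEq A] [DecidableEq B]
    [DecidableEq Z] [DecidableEq W] :
    (∀ (x : QNG.CorrType) (φ₁ : QNG.Game X Y A B) (φ₂ : QNG.Game A B Z W)
      (Γ₁ : QNG.CorrMap X Y A B) (Γ₂ : QNG.CorrMap A B Z W),
      QNG.IsPerfect φ₁ Γ₁ → QNG.InClass x Γ₁ → QNG.IsPerfect φ₂ Γ₂ → QNG.InClass x Γ₂ →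
        QNG.IsPerfect (φ₂.comp φ₁) (Γ₂ ∘ₗ Γ₁) ∧ QNG.InClass x (Γ₂ ∘ₗ Γ₁)) ∧
    (∀ (φ₁ : QNG.Game X X A A) (φ₂ : QNG.Game A A Z Z)
      (Γ₁ : QNG.CorrMap X X A A) (Γ₂ : QNG.CorrMap A A Z Z),
      QNG.IsPerfect φ₁ Γ₁ → QNG.IsPerfect φ₂ Γ₂ →
        (QNG.IsTracial Γ₁ → QNG.IsTracial Γ₂ →
          QNG.IsPerfect (φ₂.comp φ₁) (Γ₂ ∘ₗ Γ₁) ∧ QNG.IsTracial (Γ₂ ∘ₗ Γ₁)) ∧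
        (QNG.IsQTracial Γ₁ → QNG.IsQTracial Γ₂ →
          QNG.IsPerfect (φ₂.comp φ₁) (Γ₂ ∘ₗ Γ₁) ∧ QNG.IsQTracial (Γ₂ ∘ₗ Γ₁)) ∧
        (QNG.IsLocTracial Γ₁ → QNG.IsLocTracial Γ₂ →
          QNG.IsPerfect (φ₂.comp φ₁) (Γ₂ ∘ₗ Γ₁) ∧ QNG.IsLocTracial (Γ₂ ∘ₗ Γ₁))) := by
  refine ⟨fun x φ₁ φ₂ Γ₁ Γ₂ p₁ c₁ p₂ c₂ => ⟨p₁.comp p₂, ?_⟩, fun φ₁ φ₂ Γ₁ Γ₂ p₁ p₂ =>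
    ⟨fun c₁ c₂ => ⟨p₁.comp p₂, c₂.comp c₁⟩, fun c₁ c₂ => ⟨p₁.comp p₂, c₂.comp c₁⟩,
      fun c₁ c₂ => ⟨p₁.comp p₂, c₂.comp c₁⟩⟩⟩
  cases x with
  | loc => exact QNG.IsLoc.comp c₂ c₁
  | q => exact QNG.IsQ.comp c₂ c₁
  | qa => exact QNG.IsQA.comp (fun _ _ h₂ h₁ => h₂.comp h₁) c₂ c₁
  | qc => exact QNG.IsQC.comp c₂ c₁
  | ns => exact QNG.IsQNS.comp c₂ c₁
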